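/- Let $(Y_i,T_i)_{i\ge 1}$ be i.i.d. pairs of real random variables on a probability space $(\Omega,\mathcal T,P)$ such that $Y_i$ and $T_i$ are independent, with distribution functions $F$ and $G$ respectively. The pair $(Y_i,T_i)$ is observed if and only if $Y_i\ge T_i$ (random left truncation). Let $n=n(N)$ be the number of observed pairs among the first $N$ pairs, let $C_n(y)=\frac1n\sum I(T_i\le y\le Y_i)$, the sum being over these $n$ observed pairs, and let $$F_n(y)=1-\prod_{i:\,Y_i\le y}\frac{nC_n(Y_i)-1}{nC_n(Y_i)}$$ be the Lynden-Bell estimator, the product being over those of the $n$ observed pairs that satisfy $Y_i\le y$. For a distribution function $H$ put $a_H=\inf\{x: H(x)>0\}$ and $b_H=\sup\{x: H(x)<1\}$ (possibly infinite). Assume that $F$ and $G$ are continuous with $a_G<b_F$, and let $F_0(x)=P(Y_1\le x\mid Y_1\ge a_G)$ be the identifiable part of $F$. Let $\varphi_0:\mathbb R\to\mathbb R$ be measurable with $\int|\varphi_0|\,dF<\infty$. Then, as $N\to\infty$, almost surely $n\to\infty$, and $$\sup_{t\in\mathbb R}\left|\int_{-\infty}^t\varphi_0\,d(F_n-F_0)\right|\longrightarrow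 0\quad\text{almost surely.}$$ In particular, if $a_G\le a_F$ (in which case $F_0=F$), then $$\sup_{t\in\mathbb R}\left|\int_{-\infty}^t\varphi_0\,d(F_n-F)\right|\longrightarrow 0\quad\text{almost surely.}$$ -/

import Mathlib

open MeasureTheory ProbabilityTheory Filter Topology Set

namespace RandomTruncation

/-- The lower boundary `a_F = inf {x | F x > 0}` of a distribution function (possibly `-∞`). -/
noncomputable def lowerEnd (F : ℝ → ℝ) : EReal :=
  sInf ((fun x : ℝ => (x : EReal)) '' {x | 0 < F x})

/-- The upper boundary `b_F = sup {x | F x < 1}` of a distribution function (possibly `+∞`). -/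
noncomputable def upperEnd (F : ℝ → ℝ) : EReal :=
  sSup ((fun x : ℝ => (x : EReal)) '' {x | F x < 1})

/-- The individuals among the first `N` members of the population that are observed: those whose
variable of interest `y i` is not smaller than the truncation variable `t i`. -/
noncomputable def observed (y t : ℕ → ℝ) (N : ℕ) : Finset ℕ :=
  (Finset.range N).filter (fun i => t i ≤ y i)

/-- The number `n` of observed pairs in the population of size `N`. -/
noncomputable def sampleSize (y t : ℕ → ℝ) (N : ℕ) : ℕ := (observed y t N).card

/-- `C_n(x) = n⁻¹ ∑ I(T_i ≤ x ≤ Y_i)`, the sum being over the `n` observed pairs. -/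
noncomputable def empC (y t : ℕ → ℝ) (N : ℕ) (x : ℝ) : ℝ :=
  (1 / (sampleSize y t N : ℝ)) *
    ∑ i ∈ observed y t N, (if t i ≤ x ∧ x ≤ y i then (1 : ℝ) else 0)

/-- The Lynden-Bell estimator
`F_n(x) = 1 - ∏_{i : Y_i ≤ x} (n C_n(Y_i) - 1) / (n C_n(Y_i))`,
the product being over the observed pairs. -/
noncomputable def lyndenBellFun (y t : ℕ → ℝ) (N : ℕ) (x : ℝ) : ℝ :=
  1 - ∏ i ∈ (observed y t N).filter (fun i => y i ≤ x),
    ((sampleSize y t N : ℝ) * empC y t N (y i) - 1) / ((sampleSize y t N : ℝ) * empC y t N (y i))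

theorem one_le_size_mul_empC (y t : ℕ → ℝ) (N : ℕ) {i : ℕ} (hi : i ∈ observed y t N) :
    1 ≤ (sampleSize y t N : ℝ) * empC y t N (y i) := by
  have hn : (sampleSize y t N : ℝ) ≠ 0 := by
    have : 0 < sampleSize y t N := Finset.card_pos.mpr ⟨i, hi⟩
    exact_mod_cast this.ne'
  have hti : t i ≤ y i := (Finset.mem_filter.mp hi).2
  unfold empC
  rw [← mul_assoc, mul_one_div_cancel hn, one_mul]
  have := Finset.single_le_sum
    (f := fun j => if t j ≤ y i ∧ y i ≤ y j then (1 : ℝ) else 0)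
    (fun j _ => by positivity) hi
  simpa [hti] using this

/-- The Lynden-Bell estimator is nondecreasing and right-continuous, so that integrals with respect
to it are Lebesgue-Stieltjes integrals. -/
noncomputable def lyndenBell (y t : ℕ → ℝ) (N : ℕ) : StieltjesFunction ℝ where
  toFun := lyndenBellFun y t N
  mono' := by
    intro a b hab
    unfold lyndenBellFun
    refine sub_le_sub_left ?_ 1
    refine Finset.prod_le_prod_of_subset_of_le_one ?_ ?_ ?_
    · intro i hi
      rw [Finset.mem_filter] at hi ⊢
      exact ⟨hi.1, hi.2.trans hab⟩
    · intro i hi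
      have := one_le_size_mul_empC y t N (Finset.mem_filter.mp hi).1
      exact div_nonneg (by linarith) (by linarith)
    · intro i hi _
      have := one_le_size_mul_empC y t N (Finset.mem_filter.mp hi).1
      exact div_le_one_of_le₀ (by linarith) (by linarith)
  right_continuous' := by
    intro x
    have key : ∀ᶠ z in 𝓝[Ici x] x, ∀ i ∈ observed y t N, (y i ≤ z ↔ y i ≤ x) := by
      rw [Filter.eventually_all_finset]
      intro i _
      by_cases h : y i ≤ x
      · filter_upwards [self_mem_nhdsWithin] with z hz
        exact ⟨fun _ => h, fun _ => h.trans hz⟩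
      · filter_upwards [mem_nhdsWithin_of_mem_nhds (Iio_mem_nhds (not_le.mp h))] with z hz
        exact ⟨fun h' => absurd h' (not_le.mpr hz), fun h' => absurd h' h⟩
    refine ContinuousWithinAt.congr_of_eventuallyEq
      (f := fun _ => lyndenBellFun y t N x) continuousWithinAt_const ?_ rfl
    filter_upwards [key] with z hz
    unfold lyndenBellFun
    rw [Finset.filter_congr hz]

/-- The identifiable part of the law `μ` of `Y`, when the truncation variable has law `ν`:
the conditional law of `Y` given `Y ≥ a_G`, with distribution function
`F₀(x) = P(Y ≤ x | Y ≥ a_G)`. -/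
noncomputable def identifiableLaw (μ ν : Measure ℝ) : Measure ℝ :=
  μ[|{x : ℝ | lowerEnd (cdf ν) ≤ (x : EReal)}]

/-- `sup_{s ∈ ℝ} |∫_{-∞}^s φ d(F_n - Q)|` for a law `Q` on the line, with values in `[0, ∞]`. -/
noncomputable def supDeviation (φ : ℝ → ℝ) (y t : ℕ → ℝ) (N : ℕ) (Q : Measure ℝ) : ENNReal :=
  ⨆ s : ℝ, ENNReal.ofReal
    |(∫ x in Iic s, φ x ∂(lyndenBell y t N).measure) - ∫ x in Iic s, φ x ∂Q|

end RandomTruncation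

/-! The argument is an a priori bound, uniform in `N`, followed by approximation. The jump of `F_n`
at an observed `Y_i` is at most `1/n` times the ratio of the number of observed individuals with `Y
≥ Y_i` to the number at risk at `Y_i` (`jump_le`). Hence, for `ψ ≥ 0`, the integral of `ψ` against
`F_n` is at most `N/n` times `weightedMean ψ N` (`lintegral_lbMeasure_le`).

The weighted means are symmetric in the first `N` pairs. Deleting an individual other than `i` does
not, on average, raise the ratio at `Y_i` (`sum_card_erase_div_le`), so under an i.i.d. law they
form a reverse supermartingale. Their expectations are at most `2 ∫ ψ dμ` when `ψ` vanishes where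
`G` does (`lintegral_weightedMean_le`). The maximal inequality then bounds the probability that some
weighted mean reaches `c` by `2 ∫ ψ dμ / c`. Consequently the integrands for which the theorem holds
are closed under `L¹` limits (`UniformLaw.of_tendsto`).

There remains the case of half-lines, that is, uniform convergence of `F_n`. Let `h` be a limit of
`1 - F_n` along an ultrafilter. The strong law for counts in rectangles yields two-sided bounds
which make the increments of `h / (1 - F)` at most an increment of `F` times an increment of a
monotone function. As `F` is continuous, `h / (1 - F)` is constant to the right of `a_G`. The
constant is found by moving the left end point towards `a_G`, where the maximal inequality makes the
mass of `F_n` negligible uniformly in `N`. Pólya's theorem gives uniformity. A Dynkin class argument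
and simple functions lead from half-lines to all integrable functions. -/

namespace RandomTruncation

/-! ### Survivor ratios and weighted sums: the leave-one-out inequality -/

/-- The individuals in `A` that are observed and at risk at `x`. -/
noncomputable def riskSet (A : Finset ℕ) (z : ℕ → ℝ × ℝ) (x : ℝ) : Finset ℕ :=
  A.filter (fun j => (z j).2 ≤ x ∧ x ≤ (z j).1)

/-- The observed individuals in `A` whose truncation variable exceeds `x`. -/
noncomputable def lateSet (A : Finset ℕ) (z : ℕ → ℝ × ℝ) (x : ℝ) : Finset ℕ :=
  A.filter (fun j => x < (z j).2 ∧ (z j).2 ≤ (z j).1)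

/-- The ratio of the number of observed individuals with `y ≥ x` to the number at risk at `x`. -/
noncomputable def survivorRatio (A : Finset ℕ) (z : ℕ → ℝ × ℝ) (x : ℝ) : ℝ :=
  1 + ((lateSet A z x).card : ℝ) / (riskSet A z x).card

/-- The sum of `φ (y i)`, weighted by the survivor ratio, over the observed individuals in `A`. -/
noncomputable def weightedSum (φ : ℝ → ENNReal) (A : Finset ℕ) (z : ℕ → ℝ × ℝ) : ENNReal :=
  ∑ i ∈ A.filter (fun i => (z i).2 ≤ (z i).1),
    φ (z i).1 * ENNReal.ofReal (survivorRatio A z (z i).1)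

/-- The average over the population of `φ (y i)` weighted by the survivor ratio. -/
noncomputable def weightedMean (φ : ℝ → ENNReal) (N : ℕ) (z : ℕ → ℝ × ℝ) : ENNReal :=
  weightedSum φ (Finset.range N) z / N

theorem survivorRatio_nonneg (A : Finset ℕ) (z : ℕ → ℝ × ℝ) (x : ℝ) :
    0 ≤ survivorRatio A z x := by
  unfold survivorRatio; positivity

/-- Write `u` and `d` for the two cardinalities. Removing a member of `U` lowers `u / d` by `1 / d`;
removing a member of `D` other than `i` raises it by `u / (d (d - 1))`. There are `u` losses and `d
- 1` gains, so they cancel. For `d = 1` there are no gains and only the inequality remains. -/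
theorem sum_card_erase_div_le {A D U : Finset ℕ} {i : ℕ} (hi : i ∈ D) (hD : D ⊆ A) (hU : U ⊆ A)
    (hDU : Disjoint D U) :
    ∑ j ∈ A.erase i, ((U.erase j).card : ℝ) / (D.erase j).card
      ≤ ((A.card : ℝ) - 1) * (U.card / D.card) := by
  classical
  set u : ℝ := (U.card : ℝ) with hudef
  set d : ℝ := (D.card : ℝ) with hddef
  have hd1 : 1 ≤ d := by
    have : 1 ≤ D.card := Finset.card_pos.mpr ⟨i, hi⟩
    rw [hddef]; exact_mod_cast this
  have hu : 0 ≤ u := by positivity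
  have hiU : i ∉ U := Finset.disjoint_left.mp hDU hi
  have hterm : ∀ j ∈ A.erase i, ((U.erase j).card : ℝ) / (D.erase j).card
      = u / d - (if j ∈ U then 1 / d else 0) + (if j ∈ D then u / (d * (d - 1)) else 0) := by
    intro j hj
    have hji := Finset.ne_of_mem_erase hj
    by_cases h1 : j ∈ U
    · have h2 : j ∉ D := Finset.disjoint_right.mp hDU h1
      rw [Finset.erase_eq_of_notMem h2, if_pos h1, if_neg h2, Finset.card_erase_of_mem h1,
        Nat.cast_sub (Finset.card_pos.mpr ⟨j, h1⟩)]
      simp only [Nat.cast_one, add_zero]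
      ring
    · rw [Finset.erase_eq_of_notMem h1, if_neg h1]
      by_cases h2 : j ∈ D
      · have h3 : 2 ≤ D.card := Finset.one_lt_card.mpr ⟨i, hi, j, h2, hji.symm⟩
        have h4 : (2 : ℝ) ≤ d := by simpa [d] using (Nat.cast_le (α := ℝ)).mpr h3
        rw [if_pos h2, Finset.card_erase_of_mem h2, Nat.cast_sub (by omega)]
        change u / (d - ((1 : ℕ) : ℝ)) = _
        have : d - 1 ≠ 0 := by linarith
        have : d ≠ 0 := by linarith
        push_cast
        field_simp
        ring
      · rw [Finset.erase_eq_of_notMem h2, if_neg h2]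
        simp [u, d]
  rw [Finset.sum_congr rfl hterm, Finset.sum_add_distrib, Finset.sum_sub_distrib,
    ← Finset.sum_filter, ← Finset.sum_filter, Finset.sum_const, Finset.sum_const, Finset.sum_const]
  have e1 : (A.erase i).filter (· ∈ U) = U := by
    ext j; simp only [Finset.mem_filter, Finset.mem_erase]
    exact ⟨fun h => h.2, fun h => ⟨⟨fun e => hiU (e ▸ h), hU h⟩, h⟩⟩
  have e2 : (A.erase i).filter (· ∈ D) = D.erase i := by
    ext j; simp only [Finset.mem_filter, Finset.mem_erase]
    exact ⟨fun h => ⟨h.1.1, h.2⟩, fun h => ⟨⟨h.1, hD h.2⟩, h.2⟩⟩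
  rw [e1, e2, Finset.card_erase_of_mem hi, Finset.card_erase_of_mem (hD hi),
    nsmul_eq_mul, nsmul_eq_mul, nsmul_eq_mul, Nat.cast_sub (Finset.card_pos.mpr ⟨i, hi⟩),
    Nat.cast_sub (Finset.card_pos.mpr ⟨i, hD hi⟩)]
  change ((A.card : ℝ) - (1 : ℕ)) * (u / d) - u * (1 / d) + (d - (1 : ℕ)) * (u / (d * (d - 1))) ≤ _
  rcases eq_or_lt_of_le hd1 with h | h
  · rw [← h]; simp [hu]
  · have : d - 1 ≠ 0 := by linarith
    have : d ≠ 0 := by linarith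
    apply le_of_eq
    push_cast
    field_simp
    ring

theorem riskSet_erase (A : Finset ℕ) (z : ℕ → ℝ × ℝ) (x : ℝ) (j : ℕ) :
    riskSet (A.erase j) z x = (riskSet A z x).erase j := Finset.filter_erase ..

theorem lateSet_erase (A : Finset ℕ) (z : ℕ → ℝ × ℝ) (x : ℝ) (j : ℕ) :
    lateSet (A.erase j) z x = (lateSet A z x).erase j := Finset.filter_erase ..

theorem disjoint_riskSet_lateSet (A : Finset ℕ) (z : ℕ → ℝ × ℝ) (x : ℝ) :
    Disjoint (riskSet A z x) (lateSet A z x) := by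
  refine Finset.disjoint_filter.mpr ?_
  intro j _ h1 h2
  exact absurd h1.1 (not_le.mpr h2.1)

theorem sum_survivorRatio_erase_le {A : Finset ℕ} {z : ℕ → ℝ × ℝ} {i : ℕ} (hi : i ∈ A)
    (hobs : (z i).2 ≤ (z i).1) :
    ∑ j ∈ A.erase i, survivorRatio (A.erase j) z (z i).1
      ≤ ((A.card : ℝ) - 1) * survivorRatio A z (z i).1 := by
  have hmem : i ∈ riskSet A z (z i).1 := Finset.mem_filter.mpr ⟨hi, hobs, le_rfl⟩
  have := sum_card_erase_div_le hmem (Finset.filter_subset _ _)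
    (U := lateSet A z (z i).1) (Finset.filter_subset _ _) (disjoint_riskSet_lateSet A z (z i).1)
  simp only [survivorRatio, riskSet_erase, lateSet_erase, Finset.sum_add_distrib]
  rw [Finset.sum_const, Finset.card_erase_of_mem hi, nsmul_eq_mul,
    Nat.cast_sub (Finset.card_pos.mpr ⟨i, hi⟩), mul_add]
  push_cast
  linarith

/-- After exchanging the sums, the term of `i` occurs only in the deletions of `j ≠ i`, which
accounts for the factor `A.card - 1`. -/
theorem sum_weightedSum_erase_le (φ : ℝ → ENNReal) (A : Finset ℕ) (z : ℕ → ℝ × ℝ) :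
    ∑ j ∈ A, weightedSum φ (A.erase j) z ≤ ((A.card - 1 : ℕ) : ENNReal) * weightedSum φ A z := by
  classical
  have h1 : ∑ j ∈ A, weightedSum φ (A.erase j) z
      = ∑ i ∈ A.filter (fun i => (z i).2 ≤ (z i).1), ∑ j ∈ A.erase i,
          φ (z i).1 * ENNReal.ofReal (survivorRatio (A.erase j) z (z i).1) := by
    unfold weightedSum
    refine Finset.sum_comm' ?_
    intro j i
    simp only [Finset.mem_filter, Finset.mem_erase]
    constructor
    · rintro ⟨h1, ⟨h2, h3⟩, h4⟩; exact ⟨⟨h2.symm, h1⟩, h3, h4⟩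
    · rintro ⟨⟨h2, h1⟩, h3, h4⟩; exact ⟨h1, ⟨h2.symm, h3⟩, h4⟩
  rw [h1, weightedSum, Finset.mul_sum]
  refine Finset.sum_le_sum fun i hi => ?_
  rw [Finset.mem_filter] at hi
  rw [← Finset.mul_sum, ← ENNReal.ofReal_sum_of_nonneg (fun j _ => survivorRatio_nonneg _ _ _),
    mul_left_comm, ← ENNReal.ofReal_natCast, ← ENNReal.ofReal_mul (by positivity)]
  gcongr
  rw [Nat.cast_sub (Finset.card_pos.mpr ⟨i, hi.1⟩)]
  simpa using sum_survivorRatio_erase_le hi.1 hi.2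

/-! ### Symmetry and measurability of the weighted means -/

theorem weightedSum_comp_perm (φ : ℝ → ENNReal) (A : Finset ℕ) (z : ℕ → ℝ × ℝ)
    (σ : Equiv.Perm ℕ) :
    weightedSum φ A (z ∘ σ) = weightedSum φ (A.map σ.toEmbedding) z := by
  have hr : ∀ x, survivorRatio A (z ∘ σ) x = survivorRatio (A.map σ.toEmbedding) z x := by
    intro x
    simp only [survivorRatio, riskSet, lateSet, Finset.filter_map, Finset.card_map]
    rfl
  simp only [weightedSum, Finset.filter_map, Finset.sum_map, hr]
  rfl

theorem weightedMean_comp_perm (φ : ℝ → ENNReal) (N : ℕ) (z : ℕ → ℝ × ℝ) (σ : Equiv.Perm ℕ)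
    (hσ : ∀ k, N ≤ k → σ k = k) : weightedMean φ N (z ∘ σ) = weightedMean φ N z := by
  rw [weightedMean, weightedSum_comp_perm, weightedMean]
  congr 2
  ext k
  simp only [Finset.mem_map_equiv, Finset.mem_range]
  constructor
  · intro h; by_contra! h'
    rw [(Equiv.symm_apply_eq σ).mpr (hσ k h').symm] at h; omega
  · intro h; by_contra! h'
    have := hσ _ h'
    rw [Equiv.apply_symm_apply] at this; omega

theorem map_swap_range (N : ℕ) {j : ℕ} (hj : j ∈ Finset.range (N + 1)) :
    (Finset.range N).map (Equiv.swap j N).toEmbedding = (Finset.range (N + 1)).erase j := by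
  ext k
  simp only [Finset.mem_map_equiv, Finset.mem_range, Finset.mem_erase, Equiv.symm_swap] at hj ⊢
  rw [Equiv.swap_apply_def]
  split_ifs <;> omega

theorem measurable_card_filter {Z : Type*} [MeasurableSpace Z] (A : Finset ℕ) (p : ℕ → Z → Prop)
    [∀ z, DecidablePred (fun j => p j z)]
    (hp : ∀ j ∈ A, MeasurableSet {z | p j z}) :
    Measurable (fun z => ((A.filter (fun j => p j z)).card : ℝ)) := by
  classical
  have : (fun z => ((A.filter (fun j => p j z)).card : ℝ))
      = fun z => ∑ j ∈ A, ({z | p j z}.indicator (fun _ => (1 : ℝ)) z) := by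
    funext z
    simp [Set.indicator_apply]
  rw [this]
  exact Finset.measurable_sum _ fun j hj => measurable_const.indicator (hp j hj)

theorem measurable_survivorRatio (A : Finset ℕ) {Z : Type*} [MeasurableSpace Z]
    {f : Z → ℕ → ℝ × ℝ} {g : Z → ℝ} (hf : Measurable f) (hg : Measurable g) :
    Measurable (fun z => survivorRatio A (f z) (g z)) := by
  have h1 : ∀ j, Measurable (fun z => (f z j).1) := fun j => ((measurable_pi_apply j).comp hf).fst
  have h2 : ∀ j, Measurable (fun z => (f z j).2) := fun j => ((measurable_pi_apply j).comp hf).snd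
  unfold survivorRatio riskSet lateSet
  refine measurable_const.add (Measurable.div ?_ ?_)
  · exact measurable_card_filter A (fun j z => g z < (f z j).2 ∧ (f z j).2 ≤ (f z j).1)
      fun j _ => (measurableSet_lt hg (h2 j)).inter (measurableSet_le (h2 j) (h1 j))
  · exact measurable_card_filter A (fun j z => (f z j).2 ≤ g z ∧ g z ≤ (f z j).1)
      fun j _ => (measurableSet_le (h2 j) hg).inter (measurableSet_le hg (h1 j))

theorem measurable_weightedMean {φ : ℝ → ENNReal} (hφ : Measurable φ) (N : ℕ) :
    Measurable (weightedMean φ N) := by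
  classical
  have h1 : ∀ j, Measurable (fun z : ℕ → ℝ × ℝ => (z j).1) := fun j => (measurable_pi_apply j).fst
  have h2 : ∀ j, Measurable (fun z : ℕ → ℝ × ℝ => (z j).2) := fun j => (measurable_pi_apply j).snd
  unfold weightedMean weightedSum
  refine Measurable.div_const ?_ _
  have : (fun z : ℕ → ℝ × ℝ => ∑ i ∈ (Finset.range N).filter (fun i => (z i).2 ≤ (z i).1),
      φ (z i).1 * ENNReal.ofReal (survivorRatio (Finset.range N) z (z i).1))
      = fun z => ∑ i ∈ Finset.range N, {z : ℕ → ℝ × ℝ | (z i).2 ≤ (z i).1}.indicator (fun z =>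
      φ (z i).1 * ENNReal.ofReal (survivorRatio (Finset.range N) z (z i).1)) z := by
    funext z
    simp [Finset.sum_filter, Set.indicator_apply]
  rw [this]
  refine Finset.measurable_sum _ fun i _ => Measurable.indicator ?_ (measurableSet_le (h2 i) (h1 i))
  exact (hφ.comp (h1 i)).mul (measurable_survivorRatio _ measurable_id (h1 i)).ennreal_ofReal

/-! ### Reverse supermartingales and the maximal inequality -/

/-- Reverse supermartingale property of the weighted means under an exchangeable law. -/
theorem setLIntegral_weightedMean_le {Q : Measure (ℕ → ℝ × ℝ)}
    (hQ : ∀ σ : Equiv.Perm ℕ, Q.map (fun z => z ∘ σ) = Q) {φ : ℝ → ENNReal} (hφ : Measurable φ)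
    (N : ℕ) {B : Set (ℕ → ℝ × ℝ)} (hB : MeasurableSet B)
    (hinv : ∀ σ : Equiv.Perm ℕ, (∀ k, N + 1 ≤ k → σ k = k) → ∀ z, z ∘ σ ∈ B ↔ z ∈ B) :
    ∫⁻ z in B, weightedMean φ N z ∂Q ≤ ∫⁻ z in B, weightedMean φ (N + 1) z ∂Q := by
  have hmeas : ∀ σ : Equiv.Perm ℕ, Measurable (fun z : ℕ → ℝ × ℝ => z ∘ σ) := fun σ =>
    measurable_pi_lambda _ fun k => measurable_pi_apply (σ k)
  -- Transposing `j` and `N` preserves both `Q` and `B`, so any one of the first `N + 1` individuals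
  -- may play the part of the omitted one. Averaging over `j` brings in the leave-one-out
  -- inequality.
  have hswap : ∀ j ∈ Finset.range (N + 1), ∫⁻ z in B, weightedMean φ N z ∂Q
      = ∫⁻ z in B, weightedSum φ ((Finset.range (N + 1)).erase j) z / N ∂Q := by
    intro j hj
    have hB' : (fun z : ℕ → ℝ × ℝ => z ∘ (Equiv.swap j N)) ⁻¹' B = B := by
      ext z
      refine hinv _ (fun k hk => Equiv.swap_apply_of_ne_of_ne ?_ ?_) z
      · have := Finset.mem_range.mp hj; omega
      · omega
    have hr : Q.restrict B
        = (Q.restrict B).map (fun z => z ∘ (Equiv.swap j N)) := by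
      conv_lhs => rw [← hQ (Equiv.swap j N)]
      rw [Measure.restrict_map (hmeas _) hB, hB']
    conv_lhs => rw [hr]
    rw [lintegral_map (measurable_weightedMean hφ N) (hmeas _)]
    refine lintegral_congr fun z => ?_
    rw [weightedMean, weightedSum_comp_perm, map_swap_range N hj]
  have hsum : ((N + 1 : ℕ) : ENNReal) * ∫⁻ z in B, weightedMean φ N z ∂Q
      ≤ ((N + 1 : ℕ) : ENNReal) * ∫⁻ z in B, weightedMean φ (N + 1) z ∂Q := by
    rw [← lintegral_const_mul _ (measurable_weightedMean hφ (N + 1))]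
    calc ((N + 1 : ℕ) : ENNReal) * ∫⁻ z in B, weightedMean φ N z ∂Q
        = ∑ j ∈ Finset.range (N + 1), ∫⁻ z in B, weightedMean φ N z ∂Q := by simp
      _ = ∑ j ∈ Finset.range (N + 1),
            ∫⁻ z in B, weightedMean φ N (z ∘ (Equiv.swap j N)) ∂Q := by
          refine Finset.sum_congr rfl fun j hj => ?_
          rw [hswap j hj]
          refine lintegral_congr fun z => ?_
          rw [weightedMean, weightedSum_comp_perm, map_swap_range N hj]
      _ = ∫⁻ z in B, ∑ j ∈ Finset.range (N + 1),
            weightedMean φ N (z ∘ (Equiv.swap j N)) ∂Q := by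
          exact (lintegral_finsetSum _ fun j _ => (measurable_weightedMean hφ N).comp (hmeas _)).symm
      _ ≤ _ := by
          refine lintegral_mono fun z => ?_
          have h0 : ∀ j ∈ Finset.range (N + 1), weightedMean φ N (z ∘ (Equiv.swap j N))
              = weightedSum φ ((Finset.range (N + 1)).erase j) z * (N : ENNReal)⁻¹ := by
            intro j hj
            rw [weightedMean, weightedSum_comp_perm, map_swap_range N hj, div_eq_mul_inv]
          rw [Finset.sum_congr rfl h0, ← Finset.sum_mul]
          have h1 := sum_weightedSum_erase_le φ (Finset.range (N + 1)) z
          rw [Finset.card_range, Nat.add_sub_cancel] at h1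
          have h2 : ((N + 1 : ℕ) : ENNReal) * weightedMean φ (N + 1) z
              = weightedSum φ (Finset.range (N + 1)) z :=
            ENNReal.mul_div_cancel (by simp) (ENNReal.natCast_ne_top _)
          rw [h2]
          rcases Nat.eq_zero_or_pos N with rfl | hN
          · simp [weightedSum]
          calc _ ≤ (N : ENNReal) * weightedSum φ (Finset.range (N + 1)) z * (N : ENNReal)⁻¹ := by
                gcongr
            _ = weightedSum φ (Finset.range (N + 1)) z := by
                rw [mul_right_comm, ENNReal.mul_inv_cancel (by simp; omega)
                  (ENNReal.natCast_ne_top _), one_mul]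
  exact (ENNReal.mul_le_mul_iff_right (by simp) (ENNReal.natCast_ne_top _)).mp hsum

/-- Maximal inequality for reverse supermartingales in discrete time. -/
theorem mul_measure_le_of_reverse_supermartingale {Z : Type*} [MeasurableSpace Z] {Q : Measure Z}
    {X : ℕ → Z → ENNReal} (hX : ∀ n, Measurable (X n)) (c K : ENNReal)
    (hstep : ∀ n M, ∫⁻ z in {z | ∀ m ∈ Finset.Icc (n + 1) M, X m z < c}, X n z ∂Q
      ≤ ∫⁻ z in {z | ∀ m ∈ Finset.Icc (n + 1) M, X m z < c}, X (n + 1) z ∂Q)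
    (hK : ∀ n, ∫⁻ z, X n z ∂Q ≤ K) :
    c * Q {z | ∃ n, c ≤ X n z} ≤ K := by
  let B : ℕ → ℕ → Set Z := fun n M => {z | ∀ m ∈ Finset.Icc n M, X m z < c}
  have hBm : ∀ n M, MeasurableSet (B n M) := by
    intro n M
    have : B n M = ⋂ m ∈ Finset.Icc n M, {z | X m z < c} := by ext; simp [B]
    rw [this]
    exact Finset.measurableSet_biInter _ fun m _ => measurableSet_lt (hX m) measurable_const
  -- Descending induction on the time `M - k`: `c` times the probability of having reached `c`
  -- between `M - k` and `M`, plus the integral of the current variable where this has not happened,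
  -- stays below `K`.
  have key : ∀ M k, k ≤ M → c * Q (B (M - k) M)ᶜ + ∫⁻ z in B (M - k) M, X (M - k) z ∂Q ≤ K := by
    intro M k
    induction k with
    | zero =>
      intro _
      refine le_trans ?_ (hK M)
      rw [← lintegral_add_compl (X M) (hBm M M), add_comm]
      simp only [Nat.sub_zero]
      gcongr
      rw [← setLIntegral_const]
      refine setLIntegral_mono (hX M) fun z hz => ?_
      obtain ⟨m, h1, h2, h3⟩ : ∃ m, M ≤ m ∧ m ≤ M ∧ c ≤ X m z := by simpa [B] using hz
      exact (le_antisymm h2 h1) ▸ h3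
    | succ k ih =>
      intro hk
      obtain ⟨n, hn⟩ : ∃ n, n = M - (k + 1) := ⟨_, rfl⟩
      have hn' : M - k = n + 1 := by omega
      have ih' := ih (by omega)
      rw [hn'] at ih'
      rw [← hn]
      have hsub : B n M ⊆ B (n + 1) M := fun z hz m hm =>
        hz m (Finset.mem_Icc.mpr ⟨by have := Finset.mem_Icc.mp hm; omega,
          (Finset.mem_Icc.mp hm).2⟩)
      have hdiff : ∀ z ∈ B (n + 1) M \ B n M, c ≤ X n z := by
        rintro z ⟨h1, h2⟩
        by_contra! h3
        refine h2 fun m hm => ?_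
        rcases eq_or_lt_of_le (Finset.mem_Icc.mp hm).1 with h | h
        · exact h ▸ h3
        · exact h1 m (Finset.mem_Icc.mpr ⟨h, (Finset.mem_Icc.mp hm).2⟩)
      have e1 : Q (B n M)ᶜ = Q (B (n + 1) M)ᶜ + Q (B (n + 1) M \ B n M) := by
        rw [← measure_union _ ((hBm _ _).diff (hBm _ _))]
        · congr 1
          ext z
          simp only [mem_compl_iff, mem_union, Set.mem_sdiff]
          have := @hsub z
          tauto
        · exact Set.disjoint_left.mpr fun z h1 h2 => h1 h2.1
      have e2 : ∫⁻ z in B (n + 1) M, X n z ∂Q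
          = ∫⁻ z in B n M, X n z ∂Q + ∫⁻ z in B (n + 1) M \ B n M, X n z ∂Q := by
        rw [← lintegral_inter_add_sdiff (X n) (B (n + 1) M) (hBm n M),
          Set.inter_eq_self_of_subset_right hsub]
      have e3 : c * Q (B (n + 1) M \ B n M) ≤ ∫⁻ z in B (n + 1) M \ B n M, X n z ∂Q := by
        rw [← setLIntegral_const]
        exact setLIntegral_mono (hX n) hdiff
      calc c * Q (B n M)ᶜ + ∫⁻ z in B n M, X n z ∂Q
          = c * Q (B (n + 1) M)ᶜ + (∫⁻ z in B n M, X n z ∂Q + c * Q (B (n + 1) M \ B n M)) := by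
            rw [e1, mul_add]; ring
        _ ≤ c * Q (B (n + 1) M)ᶜ + ∫⁻ z in B (n + 1) M, X n z ∂Q := by
            rw [e2]; gcongr
        _ ≤ c * Q (B (n + 1) M)ᶜ + ∫⁻ z in B (n + 1) M, X (n + 1) z ∂Q := by
            exact add_le_add le_rfl (hstep n M)
        _ ≤ K := ih'
  have hM : ∀ M, c * Q (B 0 M)ᶜ ≤ K := fun M => by
    have := key M M le_rfl
    rw [Nat.sub_self] at this
    exact le_self_add.trans this
  have hU : {z | ∃ n, c ≤ X n z} = ⋃ M, (B 0 M)ᶜ := by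
    ext z
    simp only [mem_ofPred_eq, mem_iUnion, mem_compl_iff, B, not_forall, not_lt]
    constructor
    · rintro ⟨n, h⟩; exact ⟨n, n, by simp, h⟩
    · rintro ⟨M, n, _, h⟩; exact ⟨n, h⟩
  have hmono : Monotone fun M => (B 0 M)ᶜ := by
    intro M M' h
    refine Set.compl_subset_compl.mpr fun z hz m hm => hz m ?_
    have := Finset.mem_Icc.mp hm
    exact Finset.mem_Icc.mpr ⟨this.1, this.2.trans h⟩
  rw [hU, hmono.measure_iUnion, ENNReal.mul_iSup]
  exact iSup_le hM

/-- Maximal inequality for the weighted means. -/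
theorem mul_measure_exists_le_weightedMean_le {Q : Measure (ℕ → ℝ × ℝ)}
    (hQ : ∀ σ : Equiv.Perm ℕ, Q.map (fun z => z ∘ σ) = Q) {φ : ℝ → ENNReal} (hφ : Measurable φ)
    (c K : ENNReal) (hK : ∀ n, ∫⁻ z, weightedMean φ n z ∂Q ≤ K) :
    c * Q {z | ∃ n, c ≤ weightedMean φ n z} ≤ K := by
  refine mul_measure_le_of_reverse_supermartingale (measurable_weightedMean hφ) c K ?_ hK
  intro n M
  refine setLIntegral_weightedMean_le hQ hφ n ?_ ?_
  · have : {z | ∀ m ∈ Finset.Icc (n + 1) M, weightedMean φ m z < c}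
        = ⋂ m ∈ Finset.Icc (n + 1) M, {z | weightedMean φ m z < c} := by ext; simp
    rw [this]
    exact Finset.measurableSet_biInter _ fun m _ =>
      measurableSet_lt (measurable_weightedMean hφ m) measurable_const
  -- The event involves only indices `m ≥ n + 1`, and each such weighted mean is invariant under
  -- permutations of the first `n + 1` pairs.
  · intro σ hσ z
    refine forall₂_congr fun m hm => ?_
    rw [weightedMean_comp_perm φ m z σ fun k hk => hσ k ((Finset.mem_Icc.mp hm).1.trans hk)]

/-! ### Permuting and resampling coordinates of a product law -/

theorem infinitePi_map_comp_perm {X : Type*} [MeasurableSpace X] (ρ : Measure X)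
    [IsProbabilityMeasure ρ] (σ : Equiv.Perm ℕ) :
    (Measure.infinitePi (fun _ : ℕ => ρ)).map (fun z => z ∘ σ)
      = Measure.infinitePi (fun _ : ℕ => ρ) := by
  have := Measure.infinitePi_map_piCongrLeft (fun _ : ℕ => ρ) σ.symm
  conv_rhs => rw [← this]
  congr 1
  funext z k
  have := MeasurableEquiv.piCongrLeft_apply_apply (β := fun _ : ℕ => X) σ.symm z (σ k)
  simpa using this.symm

theorem measurable_update_pair {X : Type*} [MeasurableSpace X] (j : ℕ) :
    Measurable (fun p : (ℕ → X) × X => Function.update p.1 j p.2) := by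
  refine measurable_pi_lambda _ fun k => ?_
  by_cases h : k = j
  · subst h; simpa using measurable_snd
  · simp only [Function.update_of_ne h]
    exact (measurable_pi_apply k).comp measurable_fst

theorem infinitePi_prod_map_update {X : Type*} [MeasurableSpace X] (ρ : Measure X)
    [IsProbabilityMeasure ρ] (j : ℕ) :
    ((Measure.infinitePi (fun _ : ℕ => ρ)).prod ρ).map
      (fun p : (ℕ → X) × X => Function.update p.1 j p.2) = Measure.infinitePi (fun _ : ℕ => ρ) := by
  classical
  have hm := measurable_update_pair (X := X) j
  refine Measure.eq_infinitePi _ fun s t ht => ?_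
  rw [Measure.map_apply hm (MeasurableSet.pi s.countable_toSet fun k _ => ht k)]
  by_cases hj : j ∈ s
  · have : (fun p : (ℕ → X) × X => Function.update p.1 j p.2) ⁻¹' (Set.pi s t)
        = (Set.pi (s.erase j : Finset ℕ) t) ×ˢ (t j) := by
      ext p
      simp only [mem_preimage, Set.mem_pi, Finset.mem_coe, mem_prod, Finset.mem_erase]
      constructor
      · intro h
        refine ⟨fun k hk => ?_, ?_⟩
        · simpa [Function.update_of_ne hk.1] using h k hk.2
        · simpa using h j hj
      · rintro ⟨h1, h2⟩ k hk
        by_cases hkj : k = j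
        · subst hkj; simpa using h2
        · simpa [Function.update_of_ne hkj] using h1 k ⟨hkj, hk⟩
    rw [this, Measure.prod_prod, Measure.infinitePi_pi _ fun k _ => ht k, mul_comm,
      Finset.mul_prod_erase s (fun k => ρ (t k)) hj]
  · have : (fun p : (ℕ → X) × X => Function.update p.1 j p.2) ⁻¹' (Set.pi s t)
        = (Set.pi s t) ×ˢ Set.univ := by
      ext p
      simp only [mem_preimage, Set.mem_pi, Finset.mem_coe, mem_prod, mem_univ, and_true]
      refine forall₂_congr fun k hk => ?_
      have hkj : k ≠ j := by rintro rfl; exact hj hk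
      rw [Function.update_of_ne hkj]
    rw [this, Measure.prod_prod, Measure.infinitePi_pi _ fun k _ => ht k]
    simp

/-- Used to integrate out the pair `j` while all the other pairs are frozen. -/
theorem lintegral_infinitePi_update {X : Type*} [MeasurableSpace X] (ρ : Measure X)
    [IsProbabilityMeasure ρ] (j : ℕ) {f : (ℕ → X) → ENNReal} (hf : Measurable f) :
    ∫⁻ z, f z ∂(Measure.infinitePi (fun _ : ℕ => ρ))
      = ∫⁻ z, ∫⁻ w, f (Function.update z j w) ∂ρ ∂(Measure.infinitePi (fun _ : ℕ => ρ)) := by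
  have hm := measurable_update_pair (X := X) j
  conv_lhs => rw [← infinitePi_prod_map_update ρ j]
  rw [lintegral_map hf hm, lintegral_prod (fun p : (ℕ → X) × X => f (Function.update p.1 j p.2))
    (hf.comp hm).aemeasurable]

theorem lintegral_infinitePi_eval {X : Type*} [MeasurableSpace X] (ρ : Measure X)
    [IsProbabilityMeasure ρ] (i : ℕ) {f : X → ENNReal} (hf : Measurable f) :
    ∫⁻ z, f (z i) ∂(Measure.infinitePi (fun _ : ℕ => ρ)) = ∫⁻ x, f x ∂ρ :=
  (measurePreserving_eval_infinitePi (fun _ : ℕ => ρ) i).lintegral_comp hf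

/-! ### Expectation of the weighted means -/

theorem measurable_inv_card_riskSet (A : Finset ℕ) (i : ℕ) :
    Measurable (fun z : ℕ → ℝ × ℝ => ((riskSet A z (z i).1).card : ENNReal)⁻¹) := by
  have h1 : ∀ j, Measurable (fun z : ℕ → ℝ × ℝ => (z j).1) := fun j => (measurable_pi_apply j).fst
  have h2 : ∀ j, Measurable (fun z : ℕ → ℝ × ℝ => (z j).2) := fun j => (measurable_pi_apply j).snd
  refine Measurable.inv ?_
  unfold riskSet
  have := measurable_card_filter A (fun j (z : ℕ → ℝ × ℝ) => (z j).2 ≤ (z i).1 ∧ (z i).1 ≤ (z j).1)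
      fun j _ => (measurableSet_le (h2 j) (h1 i)).inter (measurableSet_le (h1 i) (h1 j))
  simpa only [ENNReal.ofReal_natCast] using this.ennreal_ofReal

theorem riskSet_update (A : Finset ℕ) (z : ℕ → ℝ × ℝ) (x : ℝ) {j : ℕ} (hj : j ∉ A) (w : ℝ × ℝ) :
    riskSet A (Function.update z j w) x = riskSet A z x := by
  refine Finset.filter_congr fun k hk => ?_
  have hkj : k ≠ j := by rintro rfl; exact hj hk
  rw [Function.update_of_ne hkj]

/-- A late individual is not at risk, so deleting it leaves the risk set unchanged. With the
denominator computed without `j`, it no longer depends on the pair `j`. -/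
theorem ofReal_late_div_risk_eq {A : Finset ℕ} {z : ℕ → ℝ × ℝ} {i : ℕ} (hi : i ∈ A)
    (hobs : (z i).2 ≤ (z i).1) :
    ENNReal.ofReal (((lateSet A z (z i).1).card : ℝ) / (riskSet A z (z i).1).card)
      = ∑ j ∈ A.erase i, {w : ℝ × ℝ | (z i).1 < w.2 ∧ w.2 ≤ w.1}.indicator 1 (z j) *
          ((riskSet (A.erase j) z (z i).1).card : ENNReal)⁻¹ := by
  classical
  have hmem : i ∈ riskSet A z (z i).1 := Finset.mem_filter.mpr ⟨hi, hobs, le_rfl⟩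
  have hpos : 0 < (riskSet A z (z i).1).card := Finset.card_pos.mpr ⟨i, hmem⟩
  rw [ENNReal.ofReal_div_of_pos (by exact_mod_cast hpos), ENNReal.ofReal_natCast,
    ENNReal.ofReal_natCast]
  have : ∀ j ∈ A.erase i, {w : ℝ × ℝ | (z i).1 < w.2 ∧ w.2 ≤ w.1}.indicator 1 (z j) *
          ((riskSet (A.erase j) z (z i).1).card : ENNReal)⁻¹
      = if (z i).1 < (z j).2 ∧ (z j).2 ≤ (z j).1 then
          ((riskSet A z (z i).1).card : ENNReal)⁻¹ else 0 := by
    intro j _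
    rw [Set.indicator_apply]
    by_cases h : (z i).1 < (z j).2 ∧ (z j).2 ≤ (z j).1
    · rw [if_pos h, if_pos (by exact h), riskSet_erase, Finset.erase_eq_of_notMem]
      · simp
      · intro hj
        exact absurd (Finset.mem_filter.mp hj).2.1 (not_le.mpr h.1)
    · rw [if_neg h, if_neg (by exact h), zero_mul]
  rw [Finset.sum_congr rfl this, ← Finset.sum_filter, Finset.sum_const, nsmul_eq_mul,
    div_eq_mul_inv, Finset.filter_erase, Finset.erase_eq_of_notMem]
  · rfl
  · intro h
    exact absurd hobs (not_le.mpr (Finset.mem_filter.mp h).2.1)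

/-- If `r` individuals are at risk, `i` is one of them. Each of the other `r - 1` contributes `1 /
(r - 1)`; for `r = 1` every term vanishes. -/
theorem sum_risk_div_risk_le_one {A : Finset ℕ} {z : ℕ → ℝ × ℝ} {i : ℕ} (hi : i ∈ A)
    (hobs : (z i).2 ≤ (z i).1) :
    ∑ j ∈ A.erase i, {w : ℝ × ℝ | w.2 ≤ (z i).1 ∧ (z i).1 ≤ w.1}.indicator 1 (z j) *
          ((riskSet (A.erase j) z (z i).1).card : ENNReal)⁻¹ ≤ 1 := by
  classical
  have hmem : i ∈ riskSet A z (z i).1 := Finset.mem_filter.mpr ⟨hi, hobs, le_rfl⟩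
  have : ∀ j ∈ A.erase i, {w : ℝ × ℝ | w.2 ≤ (z i).1 ∧ (z i).1 ≤ w.1}.indicator 1 (z j) *
          ((riskSet (A.erase j) z (z i).1).card : ENNReal)⁻¹
      = if (z j).2 ≤ (z i).1 ∧ (z i).1 ≤ (z j).1 then
          (((riskSet A z (z i).1).card - 1 : ℕ) : ENNReal)⁻¹ else 0 := by
    intro j hj
    rw [Set.indicator_apply]
    by_cases h : (z j).2 ≤ (z i).1 ∧ (z i).1 ≤ (z j).1
    · rw [if_pos h, if_pos (by exact h), riskSet_erase, Finset.card_erase_of_mem]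
      · simp
      · exact Finset.mem_filter.mpr ⟨Finset.mem_of_mem_erase hj, h⟩
    · rw [if_neg h, if_neg (by exact h), zero_mul]
  rw [Finset.sum_congr rfl this, ← Finset.sum_filter, Finset.sum_const, nsmul_eq_mul,
    Finset.filter_erase]
  change (((riskSet A z (z i).1).erase i).card : ENNReal) * _ ≤ 1
  rw [Finset.card_erase_of_mem hmem]
  exact ENNReal.mul_inv_le_one _

/-- Integrating out the truncation variable first produces a factor `G (Y_i)`, which cancels the
inverse. Only an inequality holds because `G` may vanish. -/
theorem lintegral_obs_inv_le {μ ν : Measure ℝ} [IsProbabilityMeasure μ] [IsProbabilityMeasure ν]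
    {φ : ℝ → ENNReal} (hφ : Measurable φ) (i : ℕ) :
    ∫⁻ z, {w : ℝ × ℝ | w.2 ≤ w.1}.indicator (fun w => φ w.1 * (ν (Iic w.1))⁻¹) (z i)
      ∂(Measure.infinitePi (fun _ : ℕ => μ.prod ν)) ≤ ∫⁻ x, φ x ∂μ := by
  have hg : Measurable (fun x : ℝ => ν (Iic x)) :=
    (Monotone.measurable fun a b h => measure_mono (Iic_subset_Iic.mpr h))
  have hm : MeasurableSet {w : ℝ × ℝ | w.2 ≤ w.1} := measurableSet_le measurable_snd measurable_fst
  have hf : Measurable ({w : ℝ × ℝ | w.2 ≤ w.1}.indicator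
      (fun w => φ w.1 * (ν (Iic w.1))⁻¹)) :=
    ((hφ.comp measurable_fst).mul (hg.comp measurable_fst).inv).indicator hm
  rw [lintegral_infinitePi_eval _ i hf, lintegral_prod _ hf.aemeasurable]
  refine lintegral_mono fun x => ?_
  have : ∀ y, {w : ℝ × ℝ | w.2 ≤ w.1}.indicator (fun w => φ w.1 * (ν (Iic w.1))⁻¹) (x, y)
      = (Iic x).indicator (fun _ => φ x * (ν (Iic x))⁻¹) y := by
    intro y; simp [Set.indicator_apply]
  simp only [this]
  rw [lintegral_indicator_const measurableSet_Iic, mul_assoc, mul_comm _ (ν (Iic x))]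
  exact mul_le_of_le_one_right' (ENNReal.mul_inv_le_one _)

/-- Being late at `x` forces `Y ≥ x`, while being at risk has probability `P(Y ≥ x) G(x)` by
independence of the two coordinates. -/
theorem lintegral_late_le {μ ν : Measure ℝ} [SFinite μ] [IsProbabilityMeasure ν] {x : ℝ} (hx : ν (Iic x) ≠ 0) :
    ∫⁻ w, {w : ℝ × ℝ | x < w.2 ∧ w.2 ≤ w.1}.indicator 1 w ∂(μ.prod ν)
      ≤ (ν (Iic x))⁻¹ * ∫⁻ w, {w : ℝ × ℝ | w.2 ≤ x ∧ x ≤ w.1}.indicator 1 w ∂(μ.prod ν) := by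
  have h2 : {w : ℝ × ℝ | w.2 ≤ x ∧ x ≤ w.1} = Ici x ×ˢ Iic x := by
    ext w; simp [and_comm]
  have h1 : {w : ℝ × ℝ | x < w.2 ∧ w.2 ≤ w.1} ⊆ Ici x ×ˢ univ := by
    rintro w ⟨h, h'⟩; exact ⟨(h.le.trans h'), mem_univ _⟩
  have m1 : MeasurableSet {w : ℝ × ℝ | x < w.2 ∧ w.2 ≤ w.1} :=
    (measurableSet_lt measurable_const measurable_snd).inter
      (measurableSet_le measurable_snd measurable_fst)
  rw [lintegral_indicator_one m1, h2,
    lintegral_indicator_one (measurableSet_Ici.prod measurableSet_Iic), Measure.prod_prod,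
    mul_comm (μ _), ← mul_assoc, ENNReal.inv_mul_cancel hx (measure_ne_top _ _), one_mul]
  refine (measure_mono h1).trans ?_
  rw [Measure.prod_prod, measure_univ, mul_one]

/-- The risk set without `j` and the pair `i` are unaffected by the pair `j`, so integrating over
that pair alone allows "late" to be traded for "at risk" at the price `1 / G (Y_i)`. Where `G`
vanishes, so does `φ`. -/
theorem lintegral_late_mul_le {μ ν : Measure ℝ} [IsProbabilityMeasure μ] [IsProbabilityMeasure ν]
    {φ : ℝ → ENNReal} (hφ : Measurable φ)
    (hφ0 : ∀ x, ν (Iic x) = 0 → φ x = 0) {A : Finset ℕ} {i j : ℕ} (hij : j ≠ i) :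
    ∫⁻ z, {w : ℝ × ℝ | w.2 ≤ w.1}.indicator (fun w => φ w.1) (z i) *
        ({w : ℝ × ℝ | (z i).1 < w.2 ∧ w.2 ≤ w.1}.indicator 1 (z j) *
          ((riskSet (A.erase j) z (z i).1).card : ENNReal)⁻¹)
        ∂(Measure.infinitePi (fun _ : ℕ => μ.prod ν))
      ≤ ∫⁻ z, {w : ℝ × ℝ | w.2 ≤ w.1}.indicator (fun w => φ w.1 * (ν (Iic w.1))⁻¹) (z i) *
        ({w : ℝ × ℝ | w.2 ≤ (z i).1 ∧ (z i).1 ≤ w.1}.indicator 1 (z j) *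
          ((riskSet (A.erase j) z (z i).1).card : ENNReal)⁻¹)
        ∂(Measure.infinitePi (fun _ : ℕ => μ.prod ν)) := by
  have h1 : ∀ j, Measurable (fun z : ℕ → ℝ × ℝ => (z j).1) := fun j => (measurable_pi_apply j).fst
  have h2 : ∀ j, Measurable (fun z : ℕ → ℝ × ℝ => (z j).2) := fun j => (measurable_pi_apply j).snd
  have hg : Measurable (fun x : ℝ => ν (Iic x)) :=
    (Monotone.measurable fun a b h => measure_mono (Iic_subset_Iic.mpr h))
  have hm : MeasurableSet {w : ℝ × ℝ | w.2 ≤ w.1} := measurableSet_le measurable_snd measurable_fst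
  have m1 : Measurable (fun z : ℕ → ℝ × ℝ =>
      ({w : ℝ × ℝ | (z i).1 < w.2 ∧ w.2 ≤ w.1}.indicator 1 (z j) : ENNReal)) :=
    (measurable_one (α := ENNReal)).indicator
      (s := {z : ℕ → ℝ × ℝ | (z i).1 < (z j).2 ∧ (z j).2 ≤ (z j).1})
      ((measurableSet_lt (h1 i) (h2 j)).inter (measurableSet_le (h2 j) (h1 j)))
  have m2 : Measurable (fun z : ℕ → ℝ × ℝ =>
      ({w : ℝ × ℝ | w.2 ≤ (z i).1 ∧ (z i).1 ≤ w.1}.indicator 1 (z j) : ENNReal)) :=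
    (measurable_one (α := ENNReal)).indicator
      (s := {z : ℕ → ℝ × ℝ | (z j).2 ≤ (z i).1 ∧ (z i).1 ≤ (z j).1})
      ((measurableSet_le (h2 j) (h1 i)).inter (measurableSet_le (h1 i) (h1 j)))
  have m3 : Measurable (fun z : ℕ → ℝ × ℝ =>
      {w : ℝ × ℝ | w.2 ≤ w.1}.indicator (fun w => φ w.1) (z i)) :=
    ((hφ.comp measurable_fst).indicator hm).comp (measurable_pi_apply i)
  have m4 : Measurable (fun z : ℕ → ℝ × ℝ =>
      {w : ℝ × ℝ | w.2 ≤ w.1}.indicator (fun w => φ w.1 * (ν (Iic w.1))⁻¹) (z i)) :=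
    (((hφ.comp measurable_fst).mul (hg.comp measurable_fst).inv).indicator hm).comp
      (measurable_pi_apply i)
  have m5 : Measurable (fun z : ℕ → ℝ × ℝ =>
      ((riskSet (A.erase j) z (z i).1).card : ENNReal)⁻¹) := measurable_inv_card_riskSet _ i
  refine (lintegral_infinitePi_update _ j (m3.mul (m1.mul m5))).trans_le (le_trans ?_
    (lintegral_infinitePi_update _ j (m4.mul (m2.mul m5))).symm.le)
  refine lintegral_mono fun z => ?_
  simp only [Pi.mul_apply]
  have hji : i ≠ j := hij.symm
  simp only [Function.update_self, Function.update_of_ne hji,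
    riskSet_update (A.erase j) z _ (Finset.notMem_erase j A)]
  have ml : MeasurableSet {w : ℝ × ℝ | (z i).1 < w.2 ∧ w.2 ≤ w.1} :=
    (measurableSet_lt measurable_const measurable_snd).inter
      (measurableSet_le measurable_snd measurable_fst)
  have mr : MeasurableSet {w : ℝ × ℝ | w.2 ≤ (z i).1 ∧ (z i).1 ≤ w.1} :=
    (measurableSet_le measurable_snd measurable_const).inter
      (measurableSet_le measurable_const measurable_fst)
  rw [lintegral_const_mul _ ((measurable_one.indicator ml).mul_const _),
    lintegral_const_mul _ ((measurable_one.indicator mr).mul_const _),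
    lintegral_mul_const _ (measurable_one.indicator ml),
    lintegral_mul_const _ (measurable_one.indicator mr)]
  by_cases hobs : (z i).2 ≤ (z i).1
  · rw [Set.indicator_of_mem (by exact hobs), Set.indicator_of_mem (by exact hobs)]
    by_cases hx : ν (Iic (z i).1) = 0
    · simp [hφ0 _ hx]
    · rw [mul_assoc (φ _), ← mul_assoc (ν _)⁻¹]
      gcongr
      exact lintegral_late_le hx
  · rw [Set.indicator_of_notMem (by exact hobs), Set.indicator_of_notMem (by exact hobs)]
    simp

/-- The summand `1` of the survivor ratio contributes one `∫ φ dμ`. The quotient late/risk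
contributes at most another: late individuals are exchanged for individuals at risk, whose
normalized sum is at most `1`, and the price `1 / G (Y_i)` is absorbed by the probability of
observing `i`. -/
theorem lintegral_weightedMean_le {μ ν : Measure ℝ} [IsProbabilityMeasure μ] [IsProbabilityMeasure ν]
    {φ : ℝ → ENNReal} (hφ : Measurable φ)
    (hφ0 : ∀ x, ν (Iic x) = 0 → φ x = 0) (N : ℕ) :
    ∫⁻ z, weightedMean φ N z ∂(Measure.infinitePi (fun _ : ℕ => μ.prod ν))
      ≤ 2 * ∫⁻ x, φ x ∂μ := by
  classical
  set A := Finset.range N with hA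
  set π := Measure.infinitePi (fun _ : ℕ => μ.prod ν)
  have h1 : ∀ j, Measurable (fun z : ℕ → ℝ × ℝ => (z j).1) := fun j => (measurable_pi_apply j).fst
  have h2 : ∀ j, Measurable (fun z : ℕ → ℝ × ℝ => (z j).2) := fun j => (measurable_pi_apply j).snd
  have hm : MeasurableSet {w : ℝ × ℝ | w.2 ≤ w.1} := measurableSet_le measurable_snd measurable_fst
  have hg : Measurable (fun x : ℝ => ν (Iic x)) :=
    (Monotone.measurable fun a b h => measure_mono (Iic_subset_Iic.mpr h))
  let b : ℕ → (ℕ → ℝ × ℝ) → ENNReal := fun i z =>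
    {w : ℝ × ℝ | w.2 ≤ w.1}.indicator (fun w => φ w.1) (z i)
  let b' : ℕ → (ℕ → ℝ × ℝ) → ENNReal := fun i z =>
    {w : ℝ × ℝ | w.2 ≤ w.1}.indicator (fun w => φ w.1 * (ν (Iic w.1))⁻¹) (z i)
  let l : ℕ → ℕ → (ℕ → ℝ × ℝ) → ENNReal := fun i j z =>
    {w : ℝ × ℝ | (z i).1 < w.2 ∧ w.2 ≤ w.1}.indicator 1 (z j) *
          ((riskSet (A.erase j) z (z i).1).card : ENNReal)⁻¹
  let r : ℕ → ℕ → (ℕ → ℝ × ℝ) → ENNReal := fun i j z =>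
    {w : ℝ × ℝ | w.2 ≤ (z i).1 ∧ (z i).1 ≤ w.1}.indicator 1 (z j) *
          ((riskSet (A.erase j) z (z i).1).card : ENNReal)⁻¹
  have mb : ∀ i, Measurable (b i) := fun i =>
    ((hφ.comp measurable_fst).indicator hm).comp (measurable_pi_apply i)
  have mb' : ∀ i, Measurable (b' i) := fun i =>
    (((hφ.comp measurable_fst).mul (hg.comp measurable_fst).inv).indicator hm).comp
      (measurable_pi_apply i)
  have ml : ∀ i j, Measurable (l i j) := fun i j => by
    refine Measurable.mul ?_ (measurable_inv_card_riskSet _ i)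
    exact (measurable_one (α := ENNReal)).indicator
      (s := {z : ℕ → ℝ × ℝ | (z i).1 < (z j).2 ∧ (z j).2 ≤ (z j).1})
      ((measurableSet_lt (h1 i) (h2 j)).inter (measurableSet_le (h2 j) (h1 j)))
  have mr : ∀ i j, Measurable (r i j) := fun i j => by
    refine Measurable.mul ?_ (measurable_inv_card_riskSet _ i)
    exact (measurable_one (α := ENNReal)).indicator
      (s := {z : ℕ → ℝ × ℝ | (z j).2 ≤ (z i).1 ∧ (z i).1 ≤ (z j).1})
      ((measurableSet_le (h2 j) (h1 i)).inter (measurableSet_le (h1 i) (h1 j)))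
  have hsum : ∀ z, weightedSum φ A z = ∑ i ∈ A, (b i z + ∑ j ∈ A.erase i, b i z * l i j z) := by
    intro z
    rw [weightedSum, Finset.sum_filter]
    refine Finset.sum_congr rfl fun i hi => ?_
    by_cases hobs : (z i).2 ≤ (z i).1
    · rw [if_pos hobs, ← Finset.mul_sum]
      have : b i z = φ (z i).1 := Set.indicator_of_mem (by exact hobs) _
      rw [this, survivorRatio, ENNReal.ofReal_add zero_le_one (by positivity), mul_add,
        ofReal_late_div_risk_eq hi hobs]
      simp [l]
    · have : b i z = 0 := Set.indicator_of_notMem (by exact hobs) _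
      simp [this, hobs]
  have hb : ∀ i, ∫⁻ z, b i z ∂π ≤ ∫⁻ x, φ x ∂μ := by
    intro i
    calc ∫⁻ z, b i z ∂π ≤ ∫⁻ z, φ (z i).1 ∂π :=
          lintegral_mono fun z => Set.indicator_le_self _ (fun w : ℝ × ℝ => φ w.1) (z i)
      _ = ∫⁻ w, φ w.1 ∂(μ.prod ν) :=
          lintegral_infinitePi_eval (μ.prod ν) i (f := fun w => φ w.1) (hφ.comp measurable_fst)
      _ = ∫⁻ x, φ x ∂μ := by
          rw [lintegral_prod (fun w : ℝ × ℝ => φ w.1) (hφ.comp measurable_fst).aemeasurable]; simp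
  have hbl : ∀ i ∈ A, ∑ j ∈ A.erase i, ∫⁻ z, b i z * l i j z ∂π ≤ ∫⁻ x, φ x ∂μ := by
    intro i hi
    calc ∑ j ∈ A.erase i, ∫⁻ z, b i z * l i j z ∂π
        ≤ ∑ j ∈ A.erase i, ∫⁻ z, b' i z * r i j z ∂π :=
          Finset.sum_le_sum fun j hj => lintegral_late_mul_le hφ hφ0 (Finset.ne_of_mem_erase hj)
      _ = ∫⁻ z, b' i z * ∑ j ∈ A.erase i, r i j z ∂π := by
          simp only [Finset.mul_sum]
          exact (lintegral_finsetSum _ fun j _ => (mb' i).mul (mr i j)).symm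
      _ ≤ ∫⁻ z, b' i z ∂π := by
          refine lintegral_mono fun z => ?_
          by_cases hobs : (z i).2 ≤ (z i).1
          · exact mul_le_of_le_one_right' (sum_risk_div_risk_le_one hi hobs)
          · have : b' i z = 0 := Set.indicator_of_notMem (by exact hobs) _
            simp [this]
      _ ≤ ∫⁻ x, φ x ∂μ := lintegral_obs_inv_le hφ i
  have htot : ∫⁻ z, weightedSum φ A z ∂π ≤ N * (2 * ∫⁻ x, φ x ∂μ) := by
    simp only [hsum]
    calc _ = ∑ i ∈ A, ∫⁻ z, (b i z + ∑ j ∈ A.erase i, b i z * l i j z) ∂π :=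
          lintegral_finsetSum _ fun i _ =>
            (mb i).add (Finset.measurable_sum _ fun j _ => (mb i).mul (ml i j))
      _ ≤ ∑ i ∈ A, (2 * ∫⁻ x, φ x ∂μ) := by
          refine Finset.sum_le_sum fun i hi => ?_
          rw [lintegral_add_left (mb i), two_mul]
          refine add_le_add (hb i) (le_trans (le_of_eq ?_) (hbl i hi))
          exact lintegral_finsetSum _ fun j _ => (mb i).mul (ml i j)
      _ = _ := by simp [hA]
  simp only [weightedMean, div_eq_mul_inv]
  rcases Nat.eq_zero_or_pos N with rfl | hN
  · simp [weightedSum]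
  rw [lintegral_mul_const' _ _ (by simp; omega), ← div_eq_mul_inv]
  exact ENNReal.div_le_of_le_mul' htot

theorem infinitePi_exists_le_weightedMean_le {μ ν : Measure ℝ} [IsProbabilityMeasure μ] [IsProbabilityMeasure ν]
    {φ : ℝ → ENNReal} (hφ : Measurable φ)
    (hφ0 : ∀ x, ν (Iic x) = 0 → φ x = 0) (c : ENNReal) :
    c * Measure.infinitePi (fun _ : ℕ => μ.prod ν) {z | ∃ n, c ≤ weightedMean φ n z}
      ≤ 2 * ∫⁻ x, φ x ∂μ :=
  mul_measure_exists_le_weightedMean_le (infinitePi_map_comp_perm _) hφ c _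
    (lintegral_weightedMean_le hφ hφ0)

/-! ### The product-limit estimator: jumps and their domination -/

/-- The product telescopes when the factors are removed in decreasing order of `y`. This turns the
product-limit estimator into a sum of jumps. -/
theorem prod_one_sub_eq_one_sub_sum {y a : ℕ → ℝ} (s : Finset ℕ) (hy : Set.InjOn y s) :
    ∏ i ∈ s, (1 - a i) = 1 - ∑ i ∈ s, a i * ∏ k ∈ s.filter (fun k => y k < y i), (1 - a k) := by
  classical
  induction s using Finset.induction_on_max_value y with
  | empty => simp
  | insert m s hm hmax ih =>
    have hlt : ∀ k ∈ s, y k < y m := fun k hk => lt_of_le_of_ne (hmax k hk) fun e =>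
      hm (hy (by simp [hk]) (by simp) e ▸ hk)
    rw [Finset.prod_insert hm, Finset.sum_insert hm, ih (hy.mono (by simp))]
    have e1 : (insert m s).filter (fun k => y k < y m) = s := by
      rw [Finset.filter_insert, if_neg (lt_irrefl _), Finset.filter_true_of_mem hlt]
    have e2 : ∀ i ∈ s, (insert m s).filter (fun k => y k < y i)
        = s.filter (fun k => y k < y i) := fun i hi => by
      rw [Finset.filter_insert, if_neg (not_lt.mpr (hmax i hi))]
    have e3 : ∑ i ∈ s, a i * ∏ k ∈ (insert m s).filter (fun k => y k < y i), (1 - a k)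
        = ∑ i ∈ s, a i * ∏ k ∈ s.filter (fun k => y k < y i), (1 - a k) :=
      Finset.sum_congr rfl fun i hi => by rw [e2 i hi]
    rw [e1, e3, ih (hy.mono (by simp))]
    ring

/-- If `c` points satisfy `y k ≥ y i`, the factor at `i` is at most `(c - 1) / c`, and these
fractions telescope. Equality in `hr` is the untruncated case, where the product is the empirical
survival function. -/
theorem prod_one_sub_inv_mul_card_le {y r : ℕ → ℝ} (s : Finset ℕ) (hy : Set.InjOn y s)
    (hr1 : ∀ i ∈ s, 1 ≤ r i) (hr : ∀ i ∈ s, r i ≤ (s.filter (fun k => y i ≤ y k)).card) (x : ℝ) :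
    (∏ i ∈ s.filter (fun i => y i < x), (1 - (r i)⁻¹)) * s.card
      ≤ (s.filter (fun k => x ≤ y k)).card := by
  classical
  induction s using Finset.induction_on_min_value y with
  | empty => simp
  | insert m s hm hmin ih =>
    have hlt : ∀ k ∈ s, y m < y k := fun k hk => lt_of_le_of_ne (hmin k hk) fun e =>
      hm (hy (by simp) (by simp [hk]) e ▸ hk)
    by_cases hx : y m < x
    · have ih' := ih (hy.mono (by simp)) (fun i hi => hr1 i (by simp [hi])) (fun i hi => by
        have := hr i (by simp [hi])
        rwa [Finset.filter_insert, if_neg (not_le.mpr (hlt i hi))] at this)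
      have hrm := hr m (by simp)
      rw [Finset.filter_true_of_mem (by simpa using hmin), Finset.card_insert_of_notMem hm] at hrm
      have hr1m := hr1 m (by simp)
      rw [Finset.filter_insert, if_pos hx, Finset.filter_insert, if_neg (not_le.mpr hx),
        Finset.prod_insert (by simp [hm]), Finset.card_insert_of_notMem hm]
      refine le_trans ?_ ih'
      have hp : 0 ≤ ∏ i ∈ s.filter (fun i => y i < x), (1 - (r i)⁻¹) :=
        Finset.prod_nonneg fun i hi => by
          have := inv_le_one_of_one_le₀ (hr1 i (by simp [(Finset.mem_filter.mp hi).1])); linarith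
      -- The least point `m` precedes all the others, so `r m` is at most the full cardinality
      -- `s.card + 1`.
      have h2 : (1 - (r m)⁻¹) * ((s.card + 1 : ℕ) : ℝ) ≤ s.card := by
        push_cast at hrm ⊢
        have : 1 ≤ (r m)⁻¹ * ((s.card : ℝ) + 1) := by
          rw [inv_mul_eq_div, le_div_iff₀ (by linarith)]; linarith
        linarith
      calc _ = (∏ i ∈ s.filter (fun i => y i < x), (1 - (r i)⁻¹))
            * ((1 - (r m)⁻¹) * ((s.card + 1 : ℕ) : ℝ)) := by ring
        _ ≤ _ := mul_le_mul_of_nonneg_left h2 hp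
    · push Not at hx
      have h1 : (insert m s).filter (fun i => y i < x) = ∅ := by
        refine Finset.filter_false_of_mem fun i hi => not_lt.mpr ?_
        rcases Finset.mem_insert.mp hi with rfl | h
        · exact hx
        · exact hx.trans (hmin i h)
      have h2 : (insert m s).filter (fun i => x ≤ y i) = insert m s := by
        refine Finset.filter_true_of_mem fun i hi => ?_
        rcases Finset.mem_insert.mp hi with rfl | h
        · exact hx
        · exact hx.trans (hmin i h)
      rw [h1, h2]; simp

/-- The observed individuals of the population `z`. -/
noncomputable abbrev obs (z : ℕ → ℝ × ℝ) (N : ℕ) : Finset ℕ :=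
  observed (fun i => (z i).1) (fun i => (z i).2) N

/-- The Lynden-Bell estimator of the population `z`, as a measure. -/
noncomputable abbrev lbMeasure (z : ℕ → ℝ × ℝ) (N : ℕ) : Measure ℝ :=
  (lyndenBell (fun i => (z i).1) (fun i => (z i).2) N).measure

/-- The number of individuals at risk at `y i`. -/
noncomputable def riskCount (z : ℕ → ℝ × ℝ) (N i : ℕ) : ℝ :=
  (riskSet (Finset.range N) z (z i).1).card

/-- The product-limit estimator of the survival function. -/
noncomputable def survival (z : ℕ → ℝ × ℝ) (N : ℕ) (x : ℝ) : ℝ :=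
  ∏ i ∈ (obs z N).filter (fun i => (z i).1 ≤ x), (1 - (riskCount z N i)⁻¹)

theorem one_le_riskCount {z : ℕ → ℝ × ℝ} {N i : ℕ} (hi : i ∈ obs z N) : 1 ≤ riskCount z N i := by
  have := Finset.mem_filter.mp hi
  have : 1 ≤ (riskSet (Finset.range N) z (z i).1).card :=
    Finset.card_pos.mpr ⟨i, Finset.mem_filter.mpr ⟨this.1, this.2, le_rfl⟩⟩
  unfold riskCount
  exact_mod_cast this

theorem inv_riskCount_mem {z : ℕ → ℝ × ℝ} {N i : ℕ} (hi : i ∈ obs z N) :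
    0 ≤ (riskCount z N i)⁻¹ ∧ (riskCount z N i)⁻¹ ≤ 1 :=
  ⟨inv_nonneg.mpr (zero_le_one.trans (one_le_riskCount hi)),
    inv_le_one_of_one_le₀ (one_le_riskCount hi)⟩

theorem sampleSize_mul_empC {z : ℕ → ℝ × ℝ} {N i : ℕ} (hi : i ∈ obs z N) :
    (sampleSize (fun i => (z i).1) (fun i => (z i).2) N : ℝ)
      * empC (fun i => (z i).1) (fun i => (z i).2) N (z i).1 = riskCount z N i := by
  have hn : (sampleSize (fun i => (z i).1) (fun i => (z i).2) N : ℝ) ≠ 0 := by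
    have : 0 < sampleSize (fun i => (z i).1) (fun i => (z i).2) N := Finset.card_pos.mpr ⟨i, hi⟩
    exact_mod_cast this.ne'
  unfold empC
  rw [← mul_assoc, mul_one_div_cancel hn, one_mul, Finset.sum_boole, observed,
    Finset.filter_filter, riskCount, riskSet]
  congr 2
  refine Finset.filter_congr fun k _ => ?_
  exact ⟨fun h => h.2, fun h => ⟨h.1.trans h.2, h⟩⟩

theorem lyndenBellFun_eq (z : ℕ → ℝ × ℝ) (N : ℕ) (x : ℝ) :
    lyndenBellFun (fun i => (z i).1) (fun i => (z i).2) N x = 1 - survival z N x := by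
  unfold lyndenBellFun survival
  congr 1
  refine Finset.prod_congr rfl fun i hi => ?_
  have hi' := (Finset.mem_filter.mp hi).1
  have := one_le_riskCount hi'
  rw [sampleSize_mul_empC hi', sub_div, div_self (by linarith), one_div]

theorem survival_nonneg (z : ℕ → ℝ × ℝ) (N : ℕ) (x : ℝ) : 0 ≤ survival z N x :=
  Finset.prod_nonneg fun i hi => by
    have := (inv_riskCount_mem (Finset.mem_filter.mp hi).1).2; linarith

theorem survival_le_one (z : ℕ → ℝ × ℝ) (N : ℕ) (x : ℝ) : survival z N x ≤ 1 :=
  Finset.prod_le_one (fun i hi => by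
    have := (inv_riskCount_mem (Finset.mem_filter.mp hi).1).2; linarith) fun i hi => by
    have := (inv_riskCount_mem (Finset.mem_filter.mp hi).1).1; linarith

theorem survival_antitone (z : ℕ → ℝ × ℝ) (N : ℕ) : Antitone (survival z N) := by
  intro a b hab
  have := (lyndenBell (fun i => (z i).1) (fun i => (z i).2) N).mono hab
  change lyndenBellFun _ _ _ _ ≤ lyndenBellFun _ _ _ _ at this
  rw [lyndenBellFun_eq, lyndenBellFun_eq] at this
  linarith

theorem lbMeasure_Iic (z : ℕ → ℝ × ℝ) (N : ℕ) (x : ℝ) :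
    lbMeasure z N (Iic x) = ENNReal.ofReal (1 - survival z N x) := by
  have hlim : Tendsto (lyndenBell (fun i => (z i).1) (fun i => (z i).2) N) atBot (𝓝 0) := by
    refine tendsto_const_nhds.congr' ?_
    have : ∀ᶠ x in atBot, ∀ i ∈ obs z N, x < (z i).1 :=
      (Filter.eventually_all_finset _).mpr fun i _ => eventually_lt_atBot _
    filter_upwards [this] with x hx
    change 0 = lyndenBellFun _ _ _ _
    rw [lyndenBellFun_eq, survival, Finset.filter_false_of_mem fun i hi => not_le.mpr (hx i hi)]
    simp
  rw [StieltjesFunction.measure_Iic _ hlim, sub_zero, ← lyndenBellFun_eq]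
  rfl

/-- The jump of the Lynden-Bell estimator at `y i`. -/
noncomputable def jump (z : ℕ → ℝ × ℝ) (N i : ℕ) : ℝ :=
  (riskCount z N i)⁻¹ *
    ∏ k ∈ (obs z N).filter (fun k => (z k).1 < (z i).1), (1 - (riskCount z N k)⁻¹)

theorem jump_nonneg {z : ℕ → ℝ × ℝ} {N i : ℕ} (hi : i ∈ obs z N) : 0 ≤ jump z N i :=
  mul_nonneg (inv_riskCount_mem hi).1 <| Finset.prod_nonneg fun k hk => by
    have := (inv_riskCount_mem (Finset.mem_filter.mp hk).1).2; linarith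

theorem one_sub_survival_eq_sum_jump {z : ℕ → ℝ × ℝ} {N : ℕ}
    (hz : Set.InjOn (fun i => (z i).1) (obs z N)) (x : ℝ) :
    1 - survival z N x = ∑ i ∈ (obs z N).filter (fun i => (z i).1 ≤ x), jump z N i := by
  rw [survival, prod_one_sub_eq_one_sub_sum (y := fun i => (z i).1) _
    (hz.mono fun i hi => (Finset.mem_filter.mp hi).1), sub_sub_cancel]
  refine Finset.sum_congr rfl fun i hi => ?_
  rw [jump, Finset.filter_filter]
  congr 2
  refine Finset.filter_congr fun k _ => ?_
  exact ⟨fun h => h.2, fun h => ⟨h.le.trans (Finset.mem_filter.mp hi).2, h⟩⟩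

theorem lbMeasure_eq_sum {z : ℕ → ℝ × ℝ} {N : ℕ}
    (hz : Set.InjOn (fun i => (z i).1) (obs z N)) :
    lbMeasure z N
      = ∑ i ∈ obs z N, ENNReal.ofReal (jump z N i) • Measure.dirac (z i).1 := by
  classical
  symm
  have : IsFiniteMeasure
      (∑ i ∈ obs z N, ENNReal.ofReal (jump z N i) • Measure.dirac (z i).1) :=
    ⟨by simp [Measure.finsetSum_apply, ENNReal.sum_lt_top]⟩
  refine Measure.ext_of_Iic _ _ fun x => ?_
  rw [lbMeasure_Iic, one_sub_survival_eq_sum_jump hz, ENNReal.ofReal_sum_of_nonneg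
    fun i hi => jump_nonneg (Finset.mem_filter.mp hi).1, Measure.finsetSum_apply, Finset.sum_filter]
  refine Finset.sum_congr rfl fun i _ => ?_
  simp [Set.indicator_apply]

theorem card_obs_ge {z : ℕ → ℝ × ℝ} {N i : ℕ} :
    (((obs z N).filter (fun k => (z i).1 ≤ (z k).1)).card : ℝ)
      = (lateSet (Finset.range N) z (z i).1).card + riskCount z N i := by
  classical
  have : (obs z N).filter (fun k => (z i).1 ≤ (z k).1)
      = lateSet (Finset.range N) z (z i).1 ∪ riskSet (Finset.range N) z (z i).1 := by
    ext k
    simp only [observed, lateSet, riskSet, Finset.mem_filter, Finset.mem_union]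
    constructor
    · rintro ⟨⟨h1, h2⟩, h3⟩
      rcases le_or_gt (z k).2 (z i).1 with h | h
      · exact Or.inr ⟨h1, h, h3⟩
      · exact Or.inl ⟨h1, h, h2⟩
    · rintro (⟨h1, h2, h3⟩ | ⟨h1, h2, h3⟩)
      · exact ⟨⟨h1, h3⟩, h2.le.trans h3⟩
      · exact ⟨⟨h1, h2.trans h3⟩, h3⟩
  rw [this, Finset.card_union_of_disjoint (disjoint_riskSet_lateSet _ _ _).symm]
  push_cast
  rfl

/-- The product over the points before `y i` is at most the fraction of observed individuals with `Y
≥ Y_i`. These are the individuals at risk together with the late ones, so dividing by the number at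
risk gives the survivor ratio. -/
theorem jump_le {z : ℕ → ℝ × ℝ} {N i : ℕ} (hz : Set.InjOn (fun i => (z i).1) (obs z N))
    (hi : i ∈ obs z N) :
    jump z N i ≤ survivorRatio (Finset.range N) z (z i).1 / (obs z N).card := by
  have h1 := one_le_riskCount hi
  have hn : (0 : ℝ) < (obs z N).card := by exact_mod_cast Finset.card_pos.mpr ⟨i, hi⟩
  have := prod_one_sub_inv_mul_card_le (y := fun i => (z i).1) (r := riskCount z N) (obs z N) hz
    (fun k hk => one_le_riskCount hk)
    (fun k _ => by rw [card_obs_ge]; exact le_add_of_nonneg_left (by positivity)) (z i).1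
  rw [card_obs_ge] at this
  have e : survivorRatio (Finset.range N) z (z i).1
      = (riskCount z N i)⁻¹ * ((lateSet (Finset.range N) z (z i).1).card + riskCount z N i) := by
    rw [mul_add, inv_mul_cancel₀ (by linarith), survivorRatio, add_comm, inv_mul_eq_div]; rfl
  rw [e, le_div_iff₀ hn, jump, mul_assoc]
  exact mul_le_mul_of_nonneg_left this (inv_riskCount_mem hi).1

/-- Links the estimator to the reverse supermartingale: every estimate uniform in `N` for `F_n`
comes from this domination. The factor `N / n` converts an average over the population into one over
the sample. -/
theorem lintegral_lbMeasure_le {z : ℕ → ℝ × ℝ} {N : ℕ}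
    (hz : Set.InjOn (fun i => (z i).1) (obs z N)) (ψ : ℝ → ENNReal) :
    ∫⁻ x, ψ x ∂(lbMeasure z N) ≤ N / (obs z N).card * weightedMean ψ N z := by
  rcases Nat.eq_zero_or_pos N with rfl | hN
  · rw [lbMeasure_eq_sum hz]; simp [observed]
  have e : (N : ENNReal) / (obs z N).card * weightedMean ψ N z
      = ∑ i ∈ obs z N, ψ (z i).1 *
        (ENNReal.ofReal (survivorRatio (Finset.range N) z (z i).1) / (obs z N).card) := by
    rw [weightedMean, div_eq_mul_inv, div_eq_mul_inv, mul_mul_mul_comm, mul_comm (N : ENNReal),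
      mul_mul_mul_comm, ENNReal.mul_inv_cancel (by simp; omega) (ENNReal.natCast_ne_top _),
      mul_one, weightedSum, Finset.sum_mul]
    refine Finset.sum_congr rfl fun i _ => ?_
    rw [mul_assoc, div_eq_mul_inv]
  rw [lbMeasure_eq_sum hz, lintegral_finsetSum_measure, e]
  refine Finset.sum_le_sum fun i hi => ?_
  rw [lintegral_smul_measure, lintegral_dirac, smul_eq_mul, mul_comm]
  gcongr
  have hn : (0 : ℝ) < (obs z N).card := by exact_mod_cast Finset.card_pos.mpr ⟨i, hi⟩
  calc _ ≤ _ := ENNReal.ofReal_le_ofReal (jump_le hz hi)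
    _ = _ := by rw [ENNReal.ofReal_div_of_pos hn, ENNReal.ofReal_natCast]

/-! ### Increments of the survival estimator and the strong law for counts -/

/-- The number of individuals of the population with pair in `B`. -/
noncomputable def count (B : Set (ℝ × ℝ)) (N : ℕ) (z : ℕ → ℝ × ℝ) : ℝ :=
  ∑ i ∈ Finset.range N, B.indicator (fun _ => 1) (z i)

theorem count_mono {B C : Set (ℝ × ℝ)} (h : B ⊆ C) (N : ℕ) (z : ℕ → ℝ × ℝ) :
    count B N z ≤ count C N z :=
  Finset.sum_le_sum fun i _ => Set.indicator_le_indicator_of_subset h (fun _ => zero_le_one) (z i)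

theorem count_nonneg (B : Set (ℝ × ℝ)) (N : ℕ) (z : ℕ → ℝ × ℝ) : 0 ≤ count B N z :=
  Finset.sum_nonneg fun i _ => Set.indicator_nonneg (fun _ _ => zero_le_one) (z i)

theorem riskCount_eq_count (z : ℕ → ℝ × ℝ) (N i : ℕ) :
    riskCount z N i = count {w | w.2 ≤ (z i).1 ∧ (z i).1 ≤ w.1} N z := by
  classical
  simp [riskCount, riskSet, count, Set.indicator_apply]

theorem card_obs_eq_count (z : ℕ → ℝ × ℝ) (N : ℕ) :
    ((obs z N).card : ℝ) = count {w | w.2 ≤ w.1} N z := by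
  classical
  simp [observed, count, Set.indicator_apply]

theorem card_obs_Ioc_eq_count (z : ℕ → ℝ × ℝ) (N : ℕ) (u v : ℝ) :
    (((obs z N).filter (fun i => u < (z i).1 ∧ (z i).1 ≤ v)).card : ℝ)
      = count {w | w.2 ≤ w.1 ∧ u < w.1 ∧ w.1 ≤ v} N z := by
  classical
  simp [observed, count, Set.indicator_apply, Finset.filter_filter]

theorem one_sub_sum_le_prod {s : Finset ℕ} {a : ℕ → ℝ} (ha : ∀ i ∈ s, 0 ≤ a i ∧ a i ≤ 1) :
    1 - ∑ i ∈ s, a i ≤ ∏ i ∈ s, (1 - a i) := by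
  classical
  induction s using Finset.induction_on with
  | empty => simp
  | insert m s hm ih =>
    have h := ha m (by simp)
    have hs : ∀ i ∈ s, 0 ≤ a i ∧ a i ≤ 1 := fun i hi => ha i (by simp [hi])
    have hp : ∏ i ∈ s, (1 - a i) ≤ 1 :=
      Finset.prod_le_one (fun i hi => by have := hs i hi; linarith)
        fun i hi => by have := hs i hi; linarith
    rw [Finset.sum_insert hm, Finset.prod_insert hm]
    nlinarith [ih hs]

theorem prod_mul_one_add_sum_le {s : Finset ℕ} {a : ℕ → ℝ} (ha : ∀ i ∈ s, 0 ≤ a i ∧ a i ≤ 1) :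
    (∏ i ∈ s, (1 - a i)) * (1 + ∑ i ∈ s, a i) ≤ 1 := by
  classical
  induction s using Finset.induction_on with
  | empty => simp
  | insert m s hm ih =>
    have h := ha m (by simp)
    have hs : ∀ i ∈ s, 0 ≤ a i ∧ a i ≤ 1 := fun i hi => ha i (by simp [hi])
    have hp : 0 ≤ ∏ i ∈ s, (1 - a i) :=
      Finset.prod_nonneg fun i hi => by have := hs i hi; linarith
    have hsum : 0 ≤ ∑ i ∈ s, a i := Finset.sum_nonneg fun i hi => (hs i hi).1
    have := ih hs
    rw [Finset.sum_insert hm, Finset.prod_insert hm]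
    have e : (1 - a m) * (∏ i ∈ s, (1 - a i)) * (1 + (a m + ∑ i ∈ s, a i))
        = (∏ i ∈ s, (1 - a i)) * (1 + ∑ i ∈ s, a i)
          - (∏ i ∈ s, (1 - a i)) * (a m * (a m + ∑ i ∈ s, a i)) := by ring
    rw [e]
    have : 0 ≤ (∏ i ∈ s, (1 - a i)) * (a m * (a m + ∑ i ∈ s, a i)) :=
      mul_nonneg hp (mul_nonneg h.1 (add_nonneg h.1 hsum))
    linarith

theorem survival_eq_mul {z : ℕ → ℝ × ℝ} {N : ℕ} {u v : ℝ} (huv : u ≤ v) :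
    survival z N v = survival z N u *
      ∏ i ∈ (obs z N).filter (fun i => u < (z i).1 ∧ (z i).1 ≤ v), (1 - (riskCount z N i)⁻¹) := by
  classical
  unfold survival
  rw [← Finset.prod_union]
  · congr 1
    ext i
    simp only [Finset.mem_filter, Finset.mem_union]
    constructor
    · rintro ⟨h1, h2⟩
      rcases le_or_gt (z i).1 u with h | h
      · exact Or.inl ⟨h1, h⟩
      · exact Or.inr ⟨h1, h, h2⟩
    · rintro (⟨h1, h2⟩ | ⟨h1, h2, h3⟩)
      · exact ⟨h1, h2.trans huv⟩
      · exact ⟨h1, h3⟩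
  · exact Finset.disjoint_filter.mpr fun i _ h1 h2 => absurd h1 (not_le.mpr h2.1)

/-- On `(u, v]` every risk count is at least the count `R` of `Y ≥ v`, `T ≤ u`, and the number of
factors is at most the count of `u < Y ≤ v`, `T ≤ v`. Taking rectangles lets the limits factor
through `F` and `G`. -/
theorem survival_mul_sub_count_le {z : ℕ → ℝ × ℝ} {N : ℕ} {u v : ℝ} (huv : u ≤ v) :
    survival z N u * (count (Ici v ×ˢ Iic u) N z - count (Ioc u v ×ˢ Iic v) N z)
      ≤ survival z N v * count (Ici v ×ˢ Iic u) N z := by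
  set s := (obs z N).filter (fun i => u < (z i).1 ∧ (z i).1 ≤ v)
  set R := count (Ici v ×ˢ Iic u) N z
  have hs : ∀ i ∈ s, i ∈ obs z N := fun i hi => (Finset.mem_filter.mp hi).1
  have hR : 0 ≤ R := count_nonneg _ _ _
  have hsum : R * ∑ i ∈ s, (riskCount z N i)⁻¹ ≤ count (Ioc u v ×ˢ Iic v) N z := by
    calc R * ∑ i ∈ s, (riskCount z N i)⁻¹ = ∑ i ∈ s, R * (riskCount z N i)⁻¹ := Finset.mul_sum ..
      _ ≤ ∑ i ∈ s, (1 : ℝ) := by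
          refine Finset.sum_le_sum fun i hi => ?_
          have h1 := one_le_riskCount (hs i hi)
          have h2 : R ≤ riskCount z N i := by
            rw [riskCount_eq_count]
            refine count_mono ?_ N z
            rintro w ⟨hw1, hw2⟩
            have := (Finset.mem_filter.mp hi).2
            exact ⟨le_trans hw2 this.1.le, this.2.trans hw1⟩
          rw [← div_eq_mul_inv]
          exact div_le_one_of_le₀ h2 (by linarith)
      _ = s.card := by simp
      _ ≤ _ := by
          rw [card_obs_Ioc_eq_count]
          refine count_mono ?_ N z
          rintro w ⟨h1, h2, h3⟩
          exact ⟨⟨h2, h3⟩, h1.trans h3⟩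
  rw [survival_eq_mul huv, mul_assoc]
  refine mul_le_mul_of_nonneg_left ?_ (survival_nonneg _ _ _)
  have := mul_le_mul_of_nonneg_right (one_sub_sum_le_prod fun i hi => inv_riskCount_mem (hs i hi)) hR
  linarith

/-- The reverse comparison: risk counts are at most the count `R` of `Y ≥ u`, `T ≤ v`, the number of
factors is at least the count of `u < Y ≤ v`, `T ≤ u`, and `∏ (1 - a) ≤ 1 / (1 + ∑ a)`. -/
theorem survival_mul_add_count_le {z : ℕ → ℝ × ℝ} {N : ℕ} {u v : ℝ} (huv : u ≤ v) :
    survival z N v * (count (Ici u ×ˢ Iic v) N z + count (Ioc u v ×ˢ Iic u) N z)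
      ≤ survival z N u * count (Ici u ×ˢ Iic v) N z := by
  set s := (obs z N).filter (fun i => u < (z i).1 ∧ (z i).1 ≤ v)
  set R := count (Ici u ×ˢ Iic v) N z
  have hs : ∀ i ∈ s, i ∈ obs z N := fun i hi => (Finset.mem_filter.mp hi).1
  have hR : 0 ≤ R := count_nonneg _ _ _
  have hsum : count (Ioc u v ×ˢ Iic u) N z ≤ R * ∑ i ∈ s, (riskCount z N i)⁻¹ := by
    calc count (Ioc u v ×ˢ Iic u) N z ≤ s.card := by
          rw [card_obs_Ioc_eq_count]
          refine count_mono ?_ N z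
          rintro w ⟨⟨h1, h2⟩, h3⟩
          exact ⟨le_trans h3 h1.le, h1, h2⟩
      _ = ∑ i ∈ s, (1 : ℝ) := by simp
      _ ≤ ∑ i ∈ s, R * (riskCount z N i)⁻¹ := by
          refine Finset.sum_le_sum fun i hi => ?_
          have h1 := one_le_riskCount (hs i hi)
          have h2 : riskCount z N i ≤ R := by
            rw [riskCount_eq_count]
            refine count_mono ?_ N z
            rintro w ⟨hw1, hw2⟩
            have := (Finset.mem_filter.mp hi).2
            exact ⟨this.1.le.trans hw2, hw1.trans this.2⟩
          rw [← div_eq_mul_inv, one_le_div (by linarith)]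
          exact h2
      _ = _ := (Finset.mul_sum ..).symm
  rw [survival_eq_mul huv, mul_assoc]
  refine mul_le_mul_of_nonneg_left ?_ (survival_nonneg _ _ _)
  have hp : 0 ≤ ∏ i ∈ s, (1 - (riskCount z N i)⁻¹) := Finset.prod_nonneg fun i hi => by
    have := (inv_riskCount_mem (hs i hi)).2; linarith
  have := mul_le_mul_of_nonneg_right
    (prod_mul_one_add_sum_le fun i hi => inv_riskCount_mem (hs i hi)) hR
  have := mul_le_mul_of_nonneg_left hsum hp
  linarith

theorem ae_tendsto_count_div {ρ : Measure (ℝ × ℝ)} [IsProbabilityMeasure ρ] {B : Set (ℝ × ℝ)}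
    (hB : MeasurableSet B) :
    ∀ᵐ z ∂(Measure.infinitePi (fun _ : ℕ => ρ)),
      Tendsto (fun N : ℕ => count B N z / N) atTop (𝓝 (ρ.real B)) := by
  have hm : Measurable (B.indicator (fun _ => (1 : ℝ))) := measurable_const.indicator hB
  have hmp := fun i : ℕ => measurePreserving_eval_infinitePi (fun _ : ℕ => ρ) i
  have hint : Integrable (B.indicator (fun _ => (1 : ℝ))) ρ :=
    (integrable_const 1).indicator hB
  have h := strong_law_ae_real (μ := Measure.infinitePi (fun _ : ℕ => ρ))
    (fun i z => B.indicator (fun _ => (1 : ℝ)) (z i)) ((hmp 0).integrable_comp_of_integrable hint)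
    (fun i j hij => (iIndepFun_infinitePi (P := fun _ : ℕ => ρ)
      (X := fun _ => B.indicator (fun _ => (1 : ℝ))) fun _ => hm).indepFun hij)
    (fun i => by
      have h0 : ∀ k : ℕ, IdentDistrib (fun z : ℕ → ℝ × ℝ => z k) id
          (Measure.infinitePi (fun _ : ℕ => ρ)) ρ := fun k =>
        ⟨(measurable_pi_apply k).aemeasurable, aemeasurable_id, by
          rw [Measure.map_id]; exact (hmp k).map_eq⟩
      exact ((h0 i).trans (h0 0).symm).comp hm)
  have e : ∫ z, B.indicator (fun _ => (1 : ℝ)) (z 0) ∂(Measure.infinitePi (fun _ : ℕ => ρ))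
      = ρ.real B := by
    rw [← integral_indicator_one hB]
    have := integral_map (μ := Measure.infinitePi (fun _ : ℕ => ρ))
      (measurable_pi_apply (0 : ℕ)).aemeasurable
      (f := B.indicator (fun _ => (1 : ℝ))) hm.aestronglyMeasurable
    have e2 : (Measure.infinitePi (fun _ : ℕ => ρ)).map (fun z => z 0) = ρ := (hmp 0).map_eq
    rw [e2] at this
    exact this.symm
  rw [e] at h
  exact h

/-! ### Identification of limits and uniform convergence -/

/-- Increments of second order force constancy: on a subdivision fine enough for `F` to vary by at
most `ε` on each piece, the bounds add up to `ε (m v - m u)`. Equal subdivision keeps the points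
rational. -/
theorem eq_of_forall_abs_sub_le_mul {q F m : ℝ → ℝ} {u v : ℚ} (huv : u ≤ v) (hF : Continuous F)
    (hm : ∀ s t : ℚ, u ≤ s → s ≤ t → t ≤ v → m s ≤ m t)
    (hq : ∀ s t : ℚ, u ≤ s → s ≤ t → t ≤ v → |q t - q s| ≤ |F t - F s| * (m t - m s)) :
    q v = q u := by
  have hM : 0 ≤ m v - m u := sub_nonneg.mpr (hm u v le_rfl huv le_rfl)
  refine eq_of_forall_dist_le fun η hη => ?_
  rw [Real.dist_eq]
  obtain ⟨ε, hε, hεη⟩ : ∃ ε > 0, ε * (m v - m u) ≤ η :=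
    ⟨η / (m v - m u + 1), by positivity, by
      rw [div_mul_eq_mul_div, div_le_iff₀ (by linarith)]; nlinarith⟩
  have huc := (isCompact_Icc (a := (u : ℝ)) (b := v)).uniformContinuousOn_of_continuous
    hF.continuousOn
  obtain ⟨δ, hδ, hFδ⟩ := Metric.uniformContinuousOn_iff.mp huc ε hε
  obtain ⟨n, hn⟩ := exists_nat_gt (((v : ℝ) - u) / δ)
  have huv' : (u : ℝ) ≤ v := by exact_mod_cast huv
  have hn0 : (0 : ℝ) < n := lt_of_le_of_lt (by have := sub_nonneg.mpr huv'; positivity) hn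
  have hn0' : (0 : ℚ) < n := by exact_mod_cast hn0
  let s : ℕ → ℚ := fun k => u + k * ((v - u) / n)
  have hstep : ∀ k, s (k + 1) = s k + (v - u) / n := fun k => by simp only [s]; push_cast; ring
  have hd0 : 0 ≤ (v - u) / n := div_nonneg (sub_nonneg.mpr huv) hn0'.le
  have hsu : ∀ k, u ≤ s k := fun k => by
    simp only [s]; have : 0 ≤ (k : ℚ) * ((v - u) / n) := by positivity
    linarith
  have hsn : s n = v := by simp only [s]; field_simp; ring
  have hmono : Monotone s := monotone_nat_of_le_succ fun k => by rw [hstep]; linarith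
  have key : ∀ k ≤ n, |q (s k) - q u| ≤ ε * (m (s k) - m u) := by
    intro k
    induction k with
    | zero => simp [s]
    | succ k ih =>
      intro hk
      have ih := ih (by omega)
      have hsv : s (k + 1) ≤ v := hsn ▸ hmono hk
      have hle : s k ≤ s (k + 1) := hmono (by omega)
      have h1 := hq (s k) (s (k + 1)) (hsu k) hle hsv
      have h2 : |F (s (k + 1)) - F (s k)| ≤ ε := by
        refine (hFδ (s (k + 1)) ?_ (s k) ?_ ?_).le
        · exact ⟨by exact_mod_cast hsu _, by exact_mod_cast hsv⟩
        · exact ⟨by exact_mod_cast hsu _, by exact_mod_cast hle.trans hsv⟩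
        · rw [Real.dist_eq, hstep]
          push_cast
          rw [add_sub_cancel_left, abs_of_nonneg (by exact_mod_cast hd0), div_lt_iff₀ hn0]
          rwa [div_lt_iff₀ hδ, mul_comm] at hn
      have h3 := mul_le_mul_of_nonneg_right h2 (sub_nonneg.mpr (hm _ _ (hsu k) hle hsv))
      have h4 := abs_sub_le (q (s (k + 1))) (q (s k)) (q u)
      linarith
  have := key n le_rfl
  rw [hsn] at this
  exact this.trans hεη

/-- The discrete form of `dh / h = - dF / (1 - F)`. The bounds `h1` and `h2` differ only by the
variation of `F` and `G` over `[s, t]`, so the increment of `h / (1 - F)` is controlled by that of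
`F` times that of `G / (1 - F)`, and `h / (1 - F)` is constant. -/
theorem mul_one_sub_eq_of_bounds {F G h : ℝ → ℝ} (hFm : Monotone F) (hGm : Monotone G)
    (hF : Continuous F) {u v : ℚ} (huv : u ≤ v) (hGu : 0 < G u) (hFv : F v < 1)
    (hh : ∀ x, 0 ≤ h x ∧ h x ≤ 1)
    (h1 : ∀ s t : ℚ, s ≤ t → h s * ((1 - F t) * G s - (F t - F s) * G t) ≤ h t * ((1 - F t) * G s))
    (h2 : ∀ s t : ℚ, s ≤ t → h t * ((1 - F s) * G t + (F t - F s) * G s) ≤ h s * ((1 - F s) * G t)) :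
    h v * (1 - F u) = h u * (1 - F v) := by
  have hb : ∀ s t : ℚ, u ≤ s → s ≤ t → t ≤ v → G u ≤ G s ∧ G s ≤ G t ∧ 1 - F v ≤ 1 - F t ∧
      1 - F t ≤ 1 - F s := by
    intro s t hus hst htv
    have e1 := hGm (show (u : ℝ) ≤ s by exact_mod_cast hus)
    have e2 := hGm (show (s : ℝ) ≤ t by exact_mod_cast hst)
    have e3 := hFm (show (s : ℝ) ≤ t by exact_mod_cast hst)
    have e4 := hFm (show (t : ℝ) ≤ v by exact_mod_cast htv)
    exact ⟨e1, e2, by linarith, by linarith⟩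
  have hx : 0 < 1 - F v := by linarith
  -- `K` bounds the inverses of `G s * (1 - F t)` and `G t * (1 - F s)`, by which the two bounds are
  -- divided, for all `u ≤ s ≤ t ≤ v`.
  let K := (G u * (1 - F v))⁻¹
  have hK : 0 < K := by positivity
  have hm : ∀ s t : ℚ, u ≤ s → s ≤ t → t ≤ v → G s / (1 - F s) ≤ G t / (1 - F t) := by
    intro s t hus hst htv
    obtain ⟨e1, e2, e3, e4⟩ := hb s t hus hst htv
    exact div_le_div₀ (by linarith) e2 (by linarith) e4
  have key := eq_of_forall_abs_sub_le_mul (q := fun x => h x / (1 - F x)) (F := F)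
    (m := fun x => K * (G x / (1 - F x))) huv hF
    (fun s t a b c => mul_le_mul_of_nonneg_left (hm s t a b c) hK.le) ?_
  · have hxu : 0 < 1 - F u := by
      have := hFm (show (u : ℝ) ≤ v by exact_mod_cast huv); linarith
    rwa [div_eq_div_iff hx.ne' hxu.ne'] at key
  · intro s t hus hst htv
    obtain ⟨e1, e2, e3, e4⟩ := hb s t hus hst htv
    have h1 := h1 s t hst
    have h2 := h2 s t hst
    have hs := hh s
    have ht := hh t
    have hFst : 0 ≤ F t - F s := by linarith
    rw [abs_of_nonneg hFst, ← mul_sub]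
    set x := 1 - F s
    set x' := 1 - F t
    have hΔ : F t - F s = x - x' := by simp [x, x']
    have hx' : 0 < x' := by linarith
    have hxx : 0 < x := by linarith
    have hGs : 0 < G s := by linarith
    have hGt : 0 < G t := by linarith
    rw [hΔ] at h1 h2 hFst ⊢
    have eq1 : h t / x' - h s / x = (h t * x - h s * x') / (x * x') := by field_simp
    have eq2 : G t / x' - G s / x = (G t * x - G s * x') / (x * x') := by field_simp
    have hD : 0 ≤ G t * x - G s * x' := by nlinarith
    set D := G t * x - G s * x'
    have hKle : ∀ a b, G u ≤ a → 1 - F v ≤ b → (a * b)⁻¹ ≤ K := by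
      intro a b ha hb
      exact inv_anti₀ (by positivity) (mul_le_mul ha hb hx.le (hGu.le.trans ha))
    rw [eq1, eq2, abs_div, abs_of_pos (mul_pos hxx hx'), ← mul_div_assoc, ← mul_div_assoc]
    gcongr
    have hΔD : 0 ≤ (x - x') * D := mul_nonneg hFst hD
    rw [abs_le]
    constructor
    · have a1 : -(h s * ((x - x') * D)) ≤ (h t * x - h s * x') * (G s * x') := by
        have := mul_le_mul_of_nonneg_right h1 hxx.le
        simp only [D]; nlinarith
      have a2 : -((x - x') * D) ≤ (h t * x - h s * x') * (G s * x') := by nlinarith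
      have a3 : -((x - x') * D) * (G s * x')⁻¹ ≤ h t * x - h s * x' := by
        rw [← div_eq_mul_inv, div_le_iff₀ (by positivity)]; exact a2
      have a4 := mul_le_mul_of_nonneg_left (hKle (G s) x' e1 e3) hΔD
      linarith
    · have a1 : (h t * x - h s * x') * (G t * x) ≤ h t * ((x - x') * D) := by
        have := mul_le_mul_of_nonneg_right h2 hx'.le
        simp only [D]; nlinarith
      have a2 : (h t * x - h s * x') * (G t * x) ≤ (x - x') * D := by nlinarith
      have a3 : h t * x - h s * x' ≤ (x - x') * D * (G t * x)⁻¹ := by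
        rw [← div_eq_mul_inv, le_div_iff₀ (by positivity)]; exact a2
      have a4 := mul_le_mul_of_nonneg_left (hKle (G t) x (by linarith) (by linarith)) hΔD
      linarith

/-- Pólya's theorem: monotone functions converging pointwise to a continuous distribution function
converge uniformly. -/
theorem eventually_forall_abs_sub_le_of_monotone {f : ℕ → ℝ → ℝ} {g : ℝ → ℝ}
    (hf : ∀ N, Monotone (f N)) (hf01 : ∀ N x, 0 ≤ f N x ∧ f N x ≤ 1) (hg : Monotone g)
    (hgc : Continuous g) (hbot : Tendsto g atBot (𝓝 0)) (htop : Tendsto g atTop (𝓝 1))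
    (hlim : ∀ t : ℚ, 0 < g t → g t < 1 → Tendsto (fun N => f N t) atTop (𝓝 (g t)))
    {ε : ℝ} (hε : 0 < ε) : ∀ᶠ N in atTop, ∀ x, |f N x - g x| ≤ ε := by
  have hg0 : ∀ x, 0 ≤ g x := fun x => hg.le_of_tendsto hbot x
  have hg1 : ∀ x, g x ≤ 1 := fun x => hg.ge_of_tendsto htop x
  -- The levels `j / k` are used as a grid. A point is compared with a grid point at most two levels
  -- away, and the third `1 / k` covers the approximation errors.
  obtain ⟨k, hk⟩ := exists_nat_gt (3 / ε)
  have hk0 : (0 : ℝ) < k := lt_trans (by positivity) hk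
  have hkε : 3 / (k : ℝ) < ε := by rw [div_lt_iff₀ hk0]; rwa [div_lt_iff₀ hε, mul_comm] at hk
  have hgrid : ∀ j : ℕ, 0 < j → j < k → ∃ t : ℚ, |g t - j / k| < 1 / (4 * k) ∧ 0 < g t ∧ g t < 1 := by
    intro j hj0 hjk
    have hj0' : (0 : ℝ) < j := by exact_mod_cast hj0
    have hjk' : (j : ℝ) < k := by exact_mod_cast hjk
    have c0 : (0 : ℝ) < j / k := by positivity
    have c1 : (j : ℝ) / k < 1 := by rwa [div_lt_one hk0]
    obtain ⟨a, ha⟩ := (hbot.eventually (eventually_lt_nhds c0)).exists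
    obtain ⟨b, hb⟩ := (htop.eventually (eventually_gt_nhds c1)).exists
    obtain ⟨x, hx⟩ := mem_range_of_exists_le_of_exists_ge hgc ⟨a, ha.le⟩ ⟨b, hb.le⟩
    have hopen : IsOpen (g ⁻¹' (Ioo (j / k - 1 / (4 * k)) (j / k + 1 / (4 * k)) ∩ Ioo 0 1)) :=
      (isOpen_Ioo.inter isOpen_Ioo).preimage hgc
    have hpos : (0 : ℝ) < 1 / (4 * k) := by positivity
    obtain ⟨t, ht⟩ := Rat.isDenseEmbedding_coe_real.dense.exists_mem_open hopen
      ⟨x, by rw [mem_preimage, hx]; exact ⟨⟨by linarith, by linarith⟩, c0, c1⟩⟩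
    exact ⟨t, abs_lt.mpr ⟨by linarith [ht.1.1], by linarith [ht.1.2]⟩, ht.2.1, ht.2.2⟩
  choose! t ht using hgrid
  have hev : ∀ᶠ N in atTop, ∀ j ∈ Finset.Ioo 0 k, |f N (t j) - g (t j)| < 1 / (4 * k) := by
    rw [Filter.eventually_all_finset]
    intro j hj
    rw [Finset.mem_Ioo] at hj
    have := hlim (t j) (ht j hj.1 hj.2).2.1 (ht j hj.1 hj.2).2.2
    exact (Metric.tendsto_nhds.mp this) (1 / (4 * k)) (by positivity)
  filter_upwards [hev] with N hN x
  have hnear : ∀ j : ℕ, 0 < j → j < k → |f N (t j) - j / k| < 1 / (2 * k) := by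
    intro j h0 h1
    have a1 := hN j (Finset.mem_Ioo.mpr ⟨h0, h1⟩)
    have a2 := (ht j h0 h1).1
    have a3 := abs_sub_le (f N (t j)) (g (t j)) (j / k)
    have a4 : (1 : ℝ) / (2 * k) = 1 / (4 * k) + 1 / (4 * k) := by field_simp; ring
    linarith
  have hu : (1 : ℝ) / (4 * k) = 1 / k / 4 := by field_simp
  have hu2 : (1 : ℝ) / (2 * k) = 1 / k / 2 := by field_simp
  have hu3 : (3 : ℝ) / k = 3 * (1 / k) := by ring
  have hdiv : ∀ a : ℝ, a / k = a * (1 / k) := fun a => by ring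
  have hd : (0 : ℝ) < 1 / k := by positivity
  have hkd : (k : ℝ) * (1 / k) = 1 := by field_simp
  set d : ℝ := 1 / k
  have hgx : g x = g x * k * d := by rw [mul_assoc, hkd, mul_one]
  rw [abs_le]
  constructor
  · obtain ⟨j, hj1, hj2⟩ : ∃ j : ℕ, (j : ℝ) < g x * k + 1 ∧ g x * k ≤ j :=
      ⟨⌈g x * k⌉₊, Nat.ceil_lt_add_one (mul_nonneg (hg0 x) hk0.le), Nat.le_ceil _⟩
    -- Level `j - 1` may be too close to `g x` for its rational approximant to lie left of `x`;
    -- level `j - 2` leaves a margin. For `j ≤ 2` the bound `f N x ≥ 0` suffices.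
    rcases le_or_gt j 2 with h | h
    · have : (j : ℝ) ≤ 2 := by exact_mod_cast h
      have := mul_le_mul_of_nonneg_right (hj2.trans this) hd.le
      have := (hf01 N x).1
      linarith
    · have hjk : j - 2 < k := by
        have : g x * k ≤ k := by nlinarith [hg1 x]
        have : (j : ℝ) < (k + 1 : ℕ) := by push_cast; linarith
        have : j < k + 1 := by exact_mod_cast this
        omega
      have hcast : ((j - 2 : ℕ) : ℝ) = j - 2 := by push_cast [Nat.cast_sub h.le]; ring
      have b1 := abs_lt.mp (hnear (j - 2) (by omega) hjk)
      have b2 := abs_lt.mp (ht (j - 2) (by omega) hjk).1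
      rw [hcast, hdiv] at b1 b2
      rw [hu] at b2
      rw [hu2] at b1
      have b3 := mul_lt_mul_of_pos_right hj1 hd
      have b4 := mul_le_mul_of_nonneg_right hj2 hd.le
      have hlt : (t (j - 2) : ℝ) ≤ x := by
        by_contra! hc
        have := hg hc.le
        nlinarith
      have := hf N hlt
      nlinarith
  · obtain ⟨j, hj1, hj2⟩ : ∃ j : ℕ, (j : ℝ) ≤ g x * k ∧ g x * k < j + 1 :=
      ⟨⌊g x * k⌋₊, Nat.floor_le (mul_nonneg (hg0 x) hk0.le), Nat.lt_floor_add_one _⟩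
    have b3 := mul_le_mul_of_nonneg_right hj1 hd.le
    have b4 := mul_lt_mul_of_pos_right hj2 hd
    rcases le_or_gt k (j + 2) with h | h
    · have : (k : ℝ) ≤ j + 2 := by exact_mod_cast h
      have := mul_le_mul_of_nonneg_right this hd.le
      have := (hf01 N x).2
      nlinarith
    · have b1 := abs_lt.mp (hnear (j + 2) (by omega) h)
      have b2 := abs_lt.mp (ht (j + 2) (by omega) h).1
      push_cast at b1 b2
      rw [hdiv] at b1 b2
      rw [hu] at b2
      rw [hu2] at b1
      have hlt : x ≤ (t (j + 2) : ℝ) := by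
        by_contra! hc
        have := hg hc.le
        nlinarith
      have := hf N hlt
      nlinarith

/-! ### Reachable points and the almost sure properties of a population -/

/-- The points that the truncation variable does not exceed with positive probability. -/
def reachable (ν : Measure ℝ) : Set ℝ := {x | ν (Iic x) ≠ 0}

theorem mem_reachable_of_le {ν : Measure ℝ} {x y : ℝ} (hx : x ∈ reachable ν) (hxy : x ≤ y) :
    y ∈ reachable ν := fun h => hx (measure_mono_null (Iic_subset_Iic.mpr hxy) h)

theorem measurableSet_reachable (ν : Measure ℝ) : MeasurableSet (reachable ν) :=
  (isUpperSet_iff_Ici_subset.mpr fun _ hx _ hy => mem_reachable_of_le hx hy).ordConnected.measurableSet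

theorem mem_reachable_iff {ν : Measure ℝ} [IsProbabilityMeasure ν] {x : ℝ} :
    x ∈ reachable ν ↔ 0 < cdf ν x := by
  rw [cdf_eq_real, measureReal_def, ENNReal.toReal_pos_iff]
  simp [reachable, pos_iff_ne_zero]

theorem noAtoms_of_continuous_cdf {μ : Measure ℝ} [IsProbabilityMeasure μ]
    (hF : Continuous (cdf μ)) : NullSingletonClass μ := by
  refine ⟨fun x => ?_⟩
  rw [← measure_cdf μ, StieltjesFunction.measure_singleton,
    hF.continuousAt.continuousWithinAt.leftLim_eq, sub_self, ENNReal.ofReal_zero]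

theorem ae_injective {μ ν : Measure ℝ} [IsProbabilityMeasure μ] [IsProbabilityMeasure ν]
    [NullSingletonClass μ] :
    ∀ᵐ z ∂(Measure.infinitePi (fun _ : ℕ => μ.prod ν)), Function.Injective fun i => (z i).1 := by
  have h1 : ∀ j, Measurable (fun z : ℕ → ℝ × ℝ => (z j).1) := fun j => (measurable_pi_apply j).fst
  have : ∀ i j : ℕ, i ≠ j → ∀ᵐ z ∂(Measure.infinitePi (fun _ : ℕ => μ.prod ν)),
      (z i).1 ≠ (z j).1 := by
    intro i j hij
    have hms : MeasurableSet {z : ℕ → ℝ × ℝ | (z i).1 = (z j).1} := measurableSet_eq_fun (h1 i) (h1 j)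
    rw [ae_iff]
    simp only [not_not]
    rw [← lintegral_indicator_one hms, lintegral_infinitePi_update _ j
      (measurable_one.indicator hms)]
    refine (lintegral_congr fun z => ?_).trans lintegral_zero
    have : ∀ w : ℝ × ℝ, {z : ℕ → ℝ × ℝ | (z i).1 = (z j).1}.indicator (1 : (ℕ → ℝ × ℝ) → ENNReal)
        (Function.update z j w) = ({(z i).1} ×ˢ univ : Set (ℝ × ℝ)).indicator 1 w := by
      intro w
      simp only [Set.indicator_apply, mem_ofPred_eq, Function.update_self,
        Function.update_of_ne hij, mem_prod, mem_singleton_iff, mem_univ, and_true, Pi.one_apply]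
      simp only [eq_comm]
    simp only [this]
    rw [lintegral_indicator_one ((measurableSet_singleton _).prod MeasurableSet.univ),
      Measure.prod_prod, measure_singleton, zero_mul]
  have : ∀ᵐ z ∂(Measure.infinitePi (fun _ : ℕ => μ.prod ν)), ∀ i j : ℕ, i ≠ j →
      (z i).1 ≠ (z j).1 := by
    simp only [ae_all_iff]
    exact this
  filter_upwards [this] with z hz i j hij
  by_contra h
  exact hz i j h hij

theorem ae_obs_reachable {μ ν : Measure ℝ} [IsProbabilityMeasure μ] [IsProbabilityMeasure ν] :
    ∀ᵐ z ∂(Measure.infinitePi (fun _ : ℕ => μ.prod ν)),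
      ∀ i, (z i).2 ≤ (z i).1 → (z i).1 ∈ reachable ν := by
  rw [ae_all_iff]
  intro i
  have h : ∀ᵐ w ∂(μ.prod ν), w.2 ≤ w.1 → w.1 ∈ reachable ν := by
    have hms : MeasurableSet {w : ℝ × ℝ | w.2 ≤ w.1 → w.1 ∈ reachable ν} := by
      have e : {w : ℝ × ℝ | w.2 ≤ w.1 → w.1 ∈ reachable ν}
          = {w : ℝ × ℝ | w.2 ≤ w.1}ᶜ ∪ Prod.fst ⁻¹' reachable ν := by
        ext w; simp [imp_iff_not_or]
      rw [e]
      exact (measurableSet_le measurable_snd measurable_fst).compl.union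
        (measurable_fst (measurableSet_reachable ν))
    rw [Measure.ae_prod_iff_ae_ae hms]
    refine ae_of_all _ fun x => ?_
    by_cases hx : x ∈ reachable ν
    · exact ae_of_all _ fun _ _ => hx
    · have hx0 : ν (Iic x) = 0 := not_not.mp hx
      have := measure_eq_zero_iff_ae_notMem.mp hx0
      filter_upwards [this] with t ht h
      exact absurd h ht
  exact (measurePreserving_eval_infinitePi (fun _ : ℕ => μ.prod ν) i).quasiMeasurePreserving.ae h

theorem weightedMean_congr {φ ψ : ℝ → ENNReal} {z : ℕ → ℝ × ℝ}
    (h : ∀ i, (z i).2 ≤ (z i).1 → φ (z i).1 = ψ (z i).1) (N : ℕ) :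
    weightedMean φ N z = weightedMean ψ N z := by
  unfold weightedMean weightedSum
  congr 1
  exact Finset.sum_congr rfl fun i hi => by rw [h i (Finset.mem_filter.mp hi).2]

theorem weightedMean_mono {φ ψ : ℝ → ENNReal} (h : φ ≤ ψ) (N : ℕ) (z : ℕ → ℝ × ℝ) :
    weightedMean φ N z ≤ weightedMean ψ N z := by
  unfold weightedMean weightedSum
  gcongr
  exact h _

/-- The event that every `k ≥ K` fails is contained in the failure event of each single `k`, whose
probability is at most `2 ∫ ψ k / ε` by the maximal inequality. This tends to `0`, so no rate of
convergence is needed. Restricting `ψ k` to reachable points changes nothing, because observed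
values are almost surely reachable. -/
theorem ae_exists_forall_weightedMean_le {μ ν : Measure ℝ} [IsProbabilityMeasure μ]
    [IsProbabilityMeasure ν] {ψ : ℕ → ℝ → ENNReal} (hψ : ∀ k, Measurable (ψ k))
    (hlim : Tendsto (fun k => ∫⁻ x in reachable ν, ψ k x ∂μ) atTop (𝓝 0)) {ε : ENNReal}
    (hε : ε ≠ 0) (K : ℕ) :
    ∀ᵐ z ∂(Measure.infinitePi (fun _ : ℕ => μ.prod ν)), ∃ k ≥ K, ∀ N,
      weightedMean (ψ k) N z ≤ ε := by
  rcases eq_or_ne ε ⊤ with rfl | hε'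
  · exact ae_of_all _ fun z => ⟨K, le_rfl, fun N => le_top⟩
  have hred : ∀ᵐ z ∂(Measure.infinitePi (fun _ : ℕ => μ.prod ν)), ∃ k ≥ K, ∀ N,
      weightedMean ((reachable ν).indicator (ψ k)) N z ≤ ε := by
    rw [ae_iff]
    have hbound : ∀ k ≥ K, Measure.infinitePi (fun _ : ℕ => μ.prod ν)
        {z | ¬ ∃ k ≥ K, ∀ N, weightedMean ((reachable ν).indicator (ψ k)) N z ≤ ε}
        ≤ 2 * (∫⁻ x in reachable ν, ψ k x ∂μ) / ε := by
      intro k hk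
      have := infinitePi_exists_le_weightedMean_le (μ := μ) (ν := ν)
        ((hψ k).indicator (measurableSet_reachable ν))
        (fun x hx => Set.indicator_of_notMem (fun h => (show ν (Iic x) ≠ 0 from h) hx) _) ε
      rw [lintegral_indicator (measurableSet_reachable ν)] at this
      rw [ENNReal.le_div_iff_mul_le (Or.inl hε) (Or.inl hε'), mul_comm]
      refine le_trans ?_ this
      gcongr
      rename_i z
      intro hz
      simp only [not_exists, not_and, not_forall, not_le] at hz
      obtain ⟨N, hN⟩ := hz k hk
      exact ⟨N, hN.le⟩
    have hlim' : Tendsto (fun k => 2 * (∫⁻ x in reachable ν, ψ k x ∂μ) / ε) atTop (𝓝 0) := by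
      have h1 := ENNReal.Tendsto.const_mul (a := 2) hlim (Or.inr (by simp))
      have h2 := ENNReal.Tendsto.div_const h1 (b := ε) (Or.inr hε)
      simpa using h2
    refine le_antisymm (ge_of_tendsto hlim' ?_) zero_le
    filter_upwards [eventually_ge_atTop K] with k hk using hbound k hk
  filter_upwards [hred, ae_obs_reachable (μ := μ) (ν := ν)] with z hz hobs
  obtain ⟨k, hk, hN⟩ := hz
  refine ⟨k, hk, fun N => ?_⟩
  rw [weightedMean_congr (ψ := (reachable ν).indicator (ψ k)) fun i hi =>
    (Set.indicator_of_mem (hobs i hi) _).symm]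
  exact hN N

theorem exists_rat_reachable_lt {ν : Measure ℝ} [IsProbabilityMeasure ν]
    (hG : Continuous (cdf ν)) {x : ℝ} (hx : x ∈ reachable ν) :
    ∃ s : ℚ, (s : ℝ) < x ∧ (s : ℝ) ∈ reachable ν := by
  have hopen : IsOpen (reachable ν) := by
    have : reachable ν = (cdf ν) ⁻¹' (Ioi 0) := by ext y; exact mem_reachable_iff
    rw [this]; exact isOpen_Ioi.preimage hG
  obtain ⟨y, hyx, hy⟩ := exists_Ioc_subset_of_mem_nhds (hopen.mem_nhds hx) ⟨x - 1, by linarith⟩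
  obtain ⟨s, hs1, hs2⟩ := exists_rat_btwn hyx
  exact ⟨s, hs2, hy ⟨hs1, hs2.le⟩⟩

/-- By continuity of `G` there is no least reachable point, so these sets decrease to the empty set
as `s` decreases through the reachable rationals. -/
theorem exists_rat_measure_Iic_inter_reachable_lt {μ ν : Measure ℝ} [IsProbabilityMeasure μ]
    [IsProbabilityMeasure ν] (hG : Continuous (cdf ν)) (hne : (reachable ν).Nonempty)
    {δ : ENNReal} (hδ : 0 < δ) :
    ∃ s : ℚ, (s : ℝ) ∈ reachable ν ∧ μ (Iic (s : ℝ) ∩ reachable ν) < δ := by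
  let ι := {s : ℚ // (s : ℝ) ∈ reachable ν}
  obtain ⟨x, hx⟩ := hne
  obtain ⟨s₀, -, hs₀⟩ := exists_rat_reachable_lt hG hx
  have : Nonempty ι := ⟨⟨s₀, hs₀⟩⟩
  have hlim := tendsto_measure_iInter_atBot (μ := μ)
    (s := fun s : ι => Iic ((s : ℚ) : ℝ) ∩ reachable ν)
    (fun s => (measurableSet_Iic.inter (measurableSet_reachable ν)).nullMeasurableSet)
    (fun s t hst => inter_subset_inter_left _ (Iic_subset_Iic.mpr (by exact_mod_cast hst)))
    ⟨⟨s₀, hs₀⟩, measure_ne_top _ _⟩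
  have hempty : ⋂ s : ι, (Iic ((s : ℚ) : ℝ) ∩ reachable ν) = ∅ := by
    refine eq_empty_of_forall_notMem fun y hy => ?_
    rw [mem_iInter] at hy
    obtain ⟨s, hs, hs'⟩ := exists_rat_reachable_lt hG (hy ⟨s₀, hs₀⟩).2
    exact absurd (hy ⟨s, hs'⟩).1 (not_le.mpr hs)
  rw [hempty, measure_empty] at hlim
  obtain ⟨s, hs⟩ := (hlim.eventually (eventually_lt_nhds hδ)).exists
  exact ⟨s, s.2, hs⟩

/-- The almost sure properties of the population `z` that give the uniform convergence of the
Lynden-Bell estimator. -/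
structure Regular (μ ν : Measure ℝ) (α : ℝ) (z : ℕ → ℝ × ℝ) : Prop where
  injective : Function.Injective fun i => (z i).1
  obs_lim : Tendsto (fun N : ℕ => ((obs z N).card : ℝ) / N) atTop (𝓝 α)
  risk_lim : ∀ s t : ℚ, Tendsto (fun N : ℕ => count (Ici (t : ℝ) ×ˢ Iic (s : ℝ)) N z / N) atTop
    (𝓝 ((1 - cdf μ t) * cdf ν s))
  jump_lim : ∀ s t r : ℚ, s ≤ t → Tendsto
    (fun N : ℕ => count (Ioc (s : ℝ) t ×ˢ Iic (r : ℝ)) N z / N) atTop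
    (𝓝 ((cdf μ t - cdf μ s) * cdf ν r))
  small : ∀ n : ℕ, ∃ s : ℚ, (s : ℝ) ∈ reachable ν ∧
    μ.real (Iic (s : ℝ) ∩ reachable ν) ≤ 1 / ((n : ℝ) + 1) ∧
    ∀ N, weightedMean ((Iic (s : ℝ)).indicator 1) N z ≤ ENNReal.ofReal (1 / ((n : ℝ) + 1))

theorem real_Ici_eq {μ : Measure ℝ} [IsProbabilityMeasure μ] [NullSingletonClass μ] (t : ℝ) :
    μ.real (Ici t) = 1 - cdf μ t := by
  rw [cdf_eq_real, ← compl_Iio, probReal_compl_eq_one_sub measurableSet_Iio]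
  congr 1
  exact measureReal_congr Iio_ae_eq_Iic

theorem real_Ioc_eq {μ : Measure ℝ} [IsProbabilityMeasure μ] {s t : ℝ} (hst : s ≤ t) :
    μ.real (Ioc s t) = cdf μ t - cdf μ s := by
  rw [cdf_eq_real, cdf_eq_real, ← Iic_sdiff_Iic,
    measureReal_sdiff (Iic_subset_Iic.mpr hst) measurableSet_Iic]

theorem ae_regular {μ ν : Measure ℝ} [IsProbabilityMeasure μ] [IsProbabilityMeasure ν]
    (hF : Continuous (cdf μ)) (hG : Continuous (cdf ν)) (hne : (reachable ν).Nonempty) :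
    ∀ᵐ z ∂(Measure.infinitePi (fun _ : ℕ => μ.prod ν)),
      Regular μ ν ((μ.prod ν).real {w | w.2 ≤ w.1}) z := by
  have hμ := noAtoms_of_continuous_cdf hF
  have h1 := ae_tendsto_count_div (ρ := μ.prod ν)
    (measurableSet_le (measurable_snd (α := ℝ) (β := ℝ)) measurable_fst)
  have h2 : ∀ᵐ z ∂(Measure.infinitePi (fun _ : ℕ => μ.prod ν)), ∀ s t : ℚ,
      Tendsto (fun N : ℕ => count (Ici (t : ℝ) ×ˢ Iic (s : ℝ)) N z / N) atTop
        (𝓝 ((1 - cdf μ t) * cdf ν s)) := by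
    rw [ae_all_iff]; intro s
    rw [ae_all_iff]; intro t
    have := ae_tendsto_count_div (ρ := μ.prod ν)
      ((measurableSet_Ici (a := (t : ℝ))).prod (measurableSet_Iic (a := (s : ℝ))))
    rwa [measureReal_prod_prod, real_Ici_eq, ← cdf_eq_real] at this
  have h3 : ∀ᵐ z ∂(Measure.infinitePi (fun _ : ℕ => μ.prod ν)), ∀ s t r : ℚ, s ≤ t →
      Tendsto (fun N : ℕ => count (Ioc (s : ℝ) t ×ˢ Iic (r : ℝ)) N z / N) atTop
        (𝓝 ((cdf μ t - cdf μ s) * cdf ν r)) := by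
    rw [ae_all_iff]; intro s
    rw [ae_all_iff]; intro t
    rw [ae_all_iff]; intro r
    have := ae_tendsto_count_div (ρ := μ.prod ν)
      ((measurableSet_Ioc (a := (s : ℝ)) (b := t)).prod (measurableSet_Iic (a := (r : ℝ))))
    filter_upwards [this] with z hz hst
    rwa [measureReal_prod_prod, real_Ioc_eq (by exact_mod_cast hst), ← cdf_eq_real] at hz
  have h4 : ∀ᵐ z ∂(Measure.infinitePi (fun _ : ℕ => μ.prod ν)), ∀ n : ℕ, ∃ s : ℚ,
      (s : ℝ) ∈ reachable ν ∧ μ.real (Iic (s : ℝ) ∩ reachable ν) ≤ 1 / ((n : ℝ) + 1) ∧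
      ∀ N, weightedMean ((Iic (s : ℝ)).indicator 1) N z ≤ ENNReal.ofReal (1 / ((n : ℝ) + 1)) := by
    have hex : ∀ k : ℕ, ∃ s : ℚ, (s : ℝ) ∈ reachable ν ∧
        μ (Iic (s : ℝ) ∩ reachable ν) < ENNReal.ofReal (1 / ((k : ℝ) + 1)) := fun k =>
      exists_rat_measure_Iic_inter_reachable_lt hG hne (ENNReal.ofReal_pos.mpr (by positivity))
    choose s hs using hex
    rw [ae_all_iff]; intro n
    have hlim : Tendsto (fun k => ∫⁻ x in reachable ν, (Iic (s k : ℝ)).indicator 1 x ∂μ) atTop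
        (𝓝 0) := by
      have h0 : Tendsto (fun k : ℕ => ENNReal.ofReal (1 / ((k : ℝ) + 1))) atTop (𝓝 0) := by
        have := ENNReal.tendsto_ofReal (tendsto_one_div_add_atTop_nhds_zero_nat (𝕜 := ℝ))
        simpa using this
      refine tendsto_of_tendsto_of_tendsto_of_le_of_le tendsto_const_nhds h0 (fun _ => zero_le)
        fun k => ?_
      rw [lintegral_indicator_one measurableSet_Iic, Measure.restrict_apply measurableSet_Iic]
      exact (hs k).2.le
    have := ae_exists_forall_weightedMean_le (μ := μ) (ν := ν)
      (fun k => (measurable_one.indicator (measurableSet_Iic (a := (s k : ℝ))))) hlim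
      (ε := ENNReal.ofReal (1 / ((n : ℝ) + 1))) (ENNReal.ofReal_pos.mpr (by positivity)).ne' n
    filter_upwards [this] with z hz
    obtain ⟨k, hk, hN⟩ := hz
    refine ⟨s k, (hs k).1, ?_, hN⟩
    have h5 := ENNReal.toReal_mono ENNReal.ofReal_ne_top (hs k).2.le
    rw [ENNReal.toReal_ofReal (by positivity)] at h5
    refine h5.trans (one_div_le_one_div_of_le (by positivity) ?_)
    have : (n : ℝ) ≤ k := by exact_mod_cast hk
    linarith
  filter_upwards [ae_injective (μ := μ) (ν := ν), h1, h2, h3, h4] with z a b c d e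
  exact ⟨a, by simpa only [card_obs_eq_count] using b, c, d, e⟩

/-! ### Uniform convergence of the Lynden-Bell estimator -/

theorem one_sub_survival_mul_card_le {z : ℕ → ℝ × ℝ}
    (hz : Function.Injective fun i => (z i).1) {s ε : ℝ} (hε : 0 ≤ ε) (N : ℕ)
    (h : weightedMean ((Iic s).indicator 1) N z ≤ ENNReal.ofReal ε) :
    (1 - survival z N s) * ((obs z N).card / N) ≤ ε := by
  rcases Nat.eq_zero_or_pos (obs z N).card with h0 | h0
  · simpa [h0] using hε
  have hN : 0 < N := by
    rcases Nat.eq_zero_or_pos N with rfl | h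
    · simp [observed] at h0
    · exact h
  have h1 := lintegral_lbMeasure_le (z := z) (N := N) hz.injOn ((Iic s).indicator 1)
  rw [lintegral_indicator_one measurableSet_Iic, lbMeasure_Iic] at h1
  have h0' : (0 : ℝ) < (obs z N).card := by exact_mod_cast h0
  have hN' : (0 : ℝ) < N := by exact_mod_cast hN
  have h2 : ENNReal.ofReal (1 - survival z N s) ≤ ENNReal.ofReal (N / (obs z N).card * ε) := by
    refine h1.trans ?_
    rw [ENNReal.ofReal_mul (by positivity), ENNReal.ofReal_div_of_pos h0', ENNReal.ofReal_natCast,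
      ENNReal.ofReal_natCast]
    gcongr
  have h3 := (ENNReal.ofReal_le_ofReal_iff (by positivity)).mp h2
  calc _ ≤ (N / (obs z N).card * ε) * ((obs z N).card / N) := by gcongr
    _ = ε := by field_simp

/-- Every ultrafilter limit `h` has `h / (1 - F)` constant on reachable rationals where `F < 1`.
Near the left end `h` is close to `1` and `1 - F` is close to the mass of the reachable set, which
determines the constant. -/
theorem Regular.tendsto_survival {μ ν : Measure ℝ} [IsProbabilityMeasure μ]
    [IsProbabilityMeasure ν] (hF : Continuous (cdf μ)) {α : ℝ} (hα : 0 < α) {z : ℕ → ℝ × ℝ}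
    (hz : Regular μ ν α z) {t : ℚ} (ht : (t : ℝ) ∈ reachable ν) (ht1 : cdf μ t < 1) :
    Tendsto (fun N => survival z N t) atTop (𝓝 ((1 - cdf μ t) / μ.real (reachable ν))) := by
  -- Along an ultrafilter, compactness of `[0, 1]` gives convergence at all points at once, so no
  -- subsequence has to be extracted.
  rw [tendsto_iff_ultrafilter]
  intro U hU
  have hex : ∀ x : ℝ, ∃ h : ℝ, h ∈ Icc (0 : ℝ) 1 ∧ Tendsto (fun N => survival z N x) U (𝓝 h) := by
    intro x
    exact isCompact_Icc.ultrafilter_le_nhds (U.map fun N => survival z N x) (by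
      rw [le_principal_iff]
      exact (Filter.Eventually.of_forall fun N => ⟨survival_nonneg z N x, survival_le_one z N x⟩ :
        ∀ᶠ N : ℕ in U, survival z N x ∈ Icc (0 : ℝ) 1))
  choose h h01 hlim using hex
  have h1 : ∀ s t : ℚ, s ≤ t → h s * ((1 - cdf μ t) * cdf ν s - (cdf μ t - cdf μ s) * cdf ν t)
      ≤ h t * ((1 - cdf μ t) * cdf ν s) := by
    intro s t hst
    refine le_of_tendsto_of_tendsto' ((hlim s).mul (((hz.risk_lim s t).mono_left hU).sub
      ((hz.jump_lim s t t hst).mono_left hU))) ((hlim t).mul ((hz.risk_lim s t).mono_left hU))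
      fun N => ?_
    have := survival_mul_sub_count_le (z := z) (N := N) (show (s : ℝ) ≤ t by exact_mod_cast hst)
    rw [← sub_div, ← mul_div_assoc, ← mul_div_assoc]
    gcongr
  have h2 : ∀ s t : ℚ, s ≤ t → h t * ((1 - cdf μ s) * cdf ν t + (cdf μ t - cdf μ s) * cdf ν s)
      ≤ h s * ((1 - cdf μ s) * cdf ν t) := by
    intro s t hst
    refine le_of_tendsto_of_tendsto' ((hlim t).mul (((hz.risk_lim t s).mono_left hU).add
      ((hz.jump_lim s t s hst).mono_left hU))) ((hlim s).mul ((hz.risk_lim t s).mono_left hU))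
      fun N => ?_
    have := survival_mul_add_count_le (z := z) (N := N) (show (s : ℝ) ≤ t by exact_mod_cast hst)
    rw [← add_div, ← mul_div_assoc, ← mul_div_assoc]
    gcongr
  set m := μ.real (reachable ν)
  have hFt : 0 < 1 - cdf μ t := by linarith
  have hreach : ∀ s : ℝ, s ∈ reachable ν → 1 - cdf μ s = m - μ.real (Iic s ∩ reachable ν) := by
    intro s hs
    have e1 : 1 - cdf μ s = μ.real (Ioi s) := by
      rw [cdf_eq_real, ← compl_Iic, probReal_compl_eq_one_sub measurableSet_Iic]
    have e2 : reachable ν \ (Iic s ∩ reachable ν) = Ioi s := by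
      ext x
      simp only [Set.mem_sdiff, mem_inter_iff, mem_Iic, mem_Ioi]
      constructor
      · rintro ⟨a, b⟩; by_contra! c; exact b ⟨c, a⟩
      · intro a; exact ⟨mem_reachable_of_le hs a.le, fun c => absurd c.1 (not_le.mpr a)⟩
    rw [e1, ← e2, measureReal_sdiff inter_subset_right
      (measurableSet_Iic.inter (measurableSet_reachable ν))]
  have hm : 0 < m := by
    have := hreach t ht
    have : 0 ≤ μ.real (Iic (t : ℝ) ∩ reachable ν) := measureReal_nonneg
    linarith
  have key : ∀ n : ℕ, |h t * m - (1 - cdf μ t)| ≤ (1 + 1 / α) * (1 / ((n : ℝ) + 1)) := by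
    intro n
    set ε : ℝ := 1 / ((n : ℝ) + 1)
    have hε : 0 < ε := by positivity
    obtain ⟨s', hs'r, hs'μ, hs'w⟩ := hz.small n
    -- The constancy relation needs a left end point not exceeding `t`; both smallness properties
    -- pass to smaller points.
    let s := min s' t
    have hss' : (s : ℝ) ≤ s' := by exact_mod_cast min_le_left s' t
    have hsr : (s : ℝ) ∈ reachable ν := by
      rcases min_choice s' t with e | e <;> simp only [s, e] <;> assumption
    have hsμ : μ.real (Iic (s : ℝ) ∩ reachable ν) ≤ ε :=
      (measureReal_mono (inter_subset_inter_left _ (Iic_subset_Iic.mpr hss'))).trans hs'μ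
    have hsw : ∀ N, weightedMean ((Iic (s : ℝ)).indicator 1) N z ≤ ENNReal.ofReal ε := fun N =>
      (weightedMean_mono (Set.indicator_le_indicator_of_subset (Iic_subset_Iic.mpr hss')
        fun _ => zero_le_one) N z).trans (hs'w N)
    have hA : (1 - h s) * α ≤ ε :=
      le_of_tendsto' (((tendsto_const_nhds (x := (1 : ℝ))).sub (hlim s)).mul
        (hz.obs_lim.mono_left hU)) fun N =>
        one_sub_survival_mul_card_le hz.injective hε.le N (hsw N)
    have hA' : 1 - h s ≤ ε / α := by rwa [le_div_iff₀ hα]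
    have hB := mul_one_sub_eq_of_bounds (monotone_cdf μ) (monotone_cdf ν) hF
      (min_le_right s' t) (mem_reachable_iff.mp hsr) ht1 h01 h1 h2
    change h t * (1 - cdf μ s) = h s * (1 - cdf μ t) at hB
    rw [hreach s hsr] at hB
    have hs0 : 0 ≤ μ.real (Iic (s : ℝ) ∩ reachable ν) := measureReal_nonneg
    have ht01 := h01 t
    have hs01 := h01 s
    have hF0 := cdf_nonneg μ t
    have e : h t * m - (1 - cdf μ t)
        = h t * μ.real (Iic (s : ℝ) ∩ reachable ν) - (1 - h s) * (1 - cdf μ t) := by linarith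
    have b1 : h t * μ.real (Iic (s : ℝ) ∩ reachable ν) ≤ ε := by nlinarith [ht01.1, ht01.2]
    have b2 : 0 ≤ h t * μ.real (Iic (s : ℝ) ∩ reachable ν) := mul_nonneg ht01.1 hs0
    have b3 : (1 - h s) * (1 - cdf μ t) ≤ ε / α := by nlinarith [hs01.2]
    have b4 : 0 ≤ (1 - h s) * (1 - cdf μ t) := mul_nonneg (by linarith [hs01.2]) hFt.le
    have b5 : 0 < ε / α := by positivity
    have e5 : (1 + 1 / α) * ε = ε + ε / α := by ring
    rw [e, e5, abs_le]
    constructor <;> linarith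
  have hzero : |h t * m - (1 - cdf μ t)| ≤ 0 := by
    have := (tendsto_one_div_add_atTop_nhds_zero_nat (𝕜 := ℝ)).const_mul (1 + 1 / α)
    rw [mul_zero] at this
    exact ge_of_tendsto' this key
  have heq : h t = (1 - cdf μ t) / m := by
    rw [eq_div_iff hm.ne']
    have := abs_nonpos_iff.mp hzero
    linarith
  rw [← heq]
  exact hlim t

theorem continuous_cdf_of_nullSingletonClass {μ : Measure ℝ} [IsProbabilityMeasure μ]
    [NullSingletonClass μ] : Continuous (cdf μ) := by
  refine continuous_iff_continuousAt.mpr fun x => ?_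
  have h0 : (cdf μ).measure {x} = 0 := by rw [measure_cdf]; exact measure_singleton x
  rw [StieltjesFunction.measure_singleton, ENNReal.ofReal_eq_zero] at h0
  have h1 := (monotone_cdf μ).leftLim_le (le_refl x)
  rw [continuousAt_iff_continuous_left'_right']
  exact ⟨(monotone_cdf μ).continuousWithinAt_Iio_iff_leftLim_eq.mpr (le_antisymm h1 (by linarith)),
    ((cdf μ).right_continuous x).mono Ioi_subset_Ici_self⟩

/-- Pólya's theorem asks for convergence only where the limit lies strictly between `0` and `1`.
Positivity puts `t` in the reachable set, and being below `1` gives `cdf μ t < 1`, as the pointwise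
result requires. -/
theorem Regular.eventually_abs_sub_cdf_le {μ ν : Measure ℝ} [IsProbabilityMeasure μ]
    [IsProbabilityMeasure ν] (hF : Continuous (cdf μ)) (hm : μ (reachable ν) ≠ 0) {α : ℝ}
    (hα : 0 < α) {z : ℕ → ℝ × ℝ} (hz : Regular μ ν α z) {ε : ℝ} (hε : 0 < ε) :
    ∀ᶠ N in atTop, ∀ x, |(1 - survival z N x) - (μ[|reachable ν]).real (Iic x)| ≤ ε := by
  have hμ := noAtoms_of_continuous_cdf hF
  have hQ : IsProbabilityMeasure (μ[|reachable ν]) := cond_isProbabilityMeasure hm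
  have hQ0 : NullSingletonClass (μ[|reachable ν]) :=
    ⟨fun x => by
      rw [cond_apply (measurableSet_reachable ν)]
      rw [measure_mono_null inter_subset_right (measure_singleton x), mul_zero]⟩
  simp only [← cdf_eq_real]
  have hm0 : 0 < μ.real (reachable ν) := ENNReal.toReal_pos hm (measure_ne_top _ _)
  refine eventually_forall_abs_sub_le_of_monotone
    (fun N a b hab => by have := survival_antitone z N hab; linarith)
    (fun N x => ⟨by linarith [survival_le_one z N x], by linarith [survival_nonneg z N x]⟩)
    (monotone_cdf _) continuous_cdf_of_nullSingletonClass (tendsto_cdf_atBot _)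
    (tendsto_cdf_atTop _) ?_ hε
  intro t ht0 ht1
  have hcdf : cdf (μ[|reachable ν]) t = μ.real (reachable ν ∩ Iic (t : ℝ)) / μ.real (reachable ν) := by
    rw [cdf_eq_real, measureReal_def, cond_apply (measurableSet_reachable ν), ENNReal.toReal_mul,
      ENNReal.toReal_inv, ← measureReal_def, ← measureReal_def, inv_mul_eq_div]
  have htr : (t : ℝ) ∈ reachable ν := by
    by_contra hc
    have : reachable ν ∩ Iic (t : ℝ) = ∅ := eq_empty_of_forall_notMem fun x hx =>
      hc (mem_reachable_of_le hx.1 hx.2)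
    rw [hcdf, this] at ht0
    simp at ht0
  have e1 : μ.real (reachable ν ∩ Iic (t : ℝ)) = μ.real (reachable ν) - (1 - cdf μ t) := by
    have a1 : 1 - cdf μ t = μ.real (Ioi (t : ℝ)) := by
      rw [cdf_eq_real, ← compl_Iic, probReal_compl_eq_one_sub measurableSet_Iic]
    have a2 : reachable ν ∩ Iic (t : ℝ) = reachable ν \ Ioi (t : ℝ) := by
      rw [← compl_Ioi, Set.sdiff_eq]
    have a3 : Ioi (t : ℝ) ⊆ reachable ν := fun x hx => mem_reachable_of_le htr (le_of_lt hx)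
    rw [a1, a2, measureReal_sdiff a3 measurableSet_Ioi]
  rw [e1, sub_div, div_self hm0.ne'] at hcdf
  have ht1' : cdf μ t < 1 := by
    rw [hcdf] at ht1
    have : 0 < (1 - cdf μ t) / μ.real (reachable ν) := by linarith
    have := (div_pos_iff_of_pos_right hm0).mp this
    linarith
  rw [hcdf]
  exact tendsto_const_nhds.sub (hz.tendsto_survival hF hα htr ht1')

/-! ### From half-lines to integrable functions -/

/-- The deviation of the Lynden-Bell integrals of `φ` from the integrals with respect to `Q`. -/
noncomputable abbrev deviation (φ : ℝ → ℝ) (z : ℕ → ℝ × ℝ) (N : ℕ) (Q : Measure ℝ) : ENNReal :=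
  supDeviation φ (fun i => (z i).1) (fun i => (z i).2) N Q

/-- Almost sure convergence of the deviation for the integrand `φ`. -/
def UniformLaw (μ ν : Measure ℝ) (φ : ℝ → ℝ) : Prop :=
  ∀ᵐ z ∂(Measure.infinitePi (fun _ : ℕ => μ.prod ν)),
    Tendsto (fun N => deviation φ z N (μ[|reachable ν])) atTop (𝓝 0)

theorem integrable_lbMeasure {z : ℕ → ℝ × ℝ} (hz : Function.Injective fun i => (z i).1) (N : ℕ)
    (φ : ℝ → ℝ) : Integrable φ (lbMeasure z N) := by
  rw [lbMeasure_eq_sum hz.injOn, integrable_finsetSum_measure]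
  intro i _
  exact (integrable_dirac (by simp)).smul_measure ENNReal.ofReal_ne_top

theorem integrable_cond_reachable {μ ν : Measure ℝ} (hm : μ (reachable ν) ≠ 0) {φ : ℝ → ℝ}
    (hφ : Integrable φ μ) : Integrable φ (μ[|reachable ν]) :=
  hφ.restrict.smul_measure (ENNReal.inv_ne_top.mpr hm)

theorem deviation_le_add {Q : Measure ℝ} {z : ℕ → ℝ × ℝ}
    (hz : Function.Injective fun i => (z i).1) (N : ℕ) {φ ψ : ℝ → ℝ} (hφ : Integrable φ Q)
    (hψ : Integrable ψ Q) :
    deviation φ z N Q ≤ deviation ψ z N Q + (∫⁻ x, ‖φ x - ψ x‖ₑ ∂(lbMeasure z N)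
      + ∫⁻ x, ‖φ x - ψ x‖ₑ ∂Q) := by
  refine iSup_le fun s => ?_
  have hb : ∀ {M : Measure ℝ}, Integrable φ M → Integrable ψ M →
      ENNReal.ofReal |(∫ x in Iic s, φ x ∂M) - ∫ x in Iic s, ψ x ∂M| ≤ ∫⁻ x, ‖φ x - ψ x‖ₑ ∂M := by
    intro M h1 h2
    rw [← integral_sub h1.restrict h2.restrict, ← Real.enorm_eq_ofReal_abs]
    exact (enorm_integral_le_lintegral_enorm _).trans (setLIntegral_le_lintegral _ _)
  have h1 := hb (integrable_lbMeasure hz N φ) (integrable_lbMeasure hz N ψ)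
  have h2 := hb hφ hψ
  refine le_trans ?_ (add_le_add (le_iSup (fun s : ℝ => ENNReal.ofReal
    |(∫ x in Iic s, ψ x ∂(lbMeasure z N)) - ∫ x in Iic s, ψ x ∂Q|) s) (add_le_add h1 h2))
  rw [← ENNReal.ofReal_add (abs_nonneg _) (abs_nonneg _),
    ← ENNReal.ofReal_add (abs_nonneg _) (by positivity)]
  refine ENNReal.ofReal_le_ofReal ?_
  set a := ∫ x in Iic s, φ x ∂(lbMeasure z N)
  set b := ∫ x in Iic s, φ x ∂Q
  set c := ∫ x in Iic s, ψ x ∂(lbMeasure z N)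
  set d := ∫ x in Iic s, ψ x ∂Q
  have e1 := abs_sub_le a c b
  have e2 := abs_sub_le c d b
  rw [abs_sub_comm d b] at e2
  linarith

theorem deviation_add_le {Q : Measure ℝ} {z : ℕ → ℝ × ℝ}
    (hz : Function.Injective fun i => (z i).1) (N : ℕ) {φ ψ : ℝ → ℝ} (hφ : Integrable φ Q)
    (hψ : Integrable ψ Q) :
    deviation (fun x => φ x + ψ x) z N Q ≤ deviation φ z N Q + deviation ψ z N Q := by
  refine iSup_le fun s => ?_
  refine le_trans ?_ (add_le_add (le_iSup (fun s : ℝ => ENNReal.ofReal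
    |(∫ x in Iic s, φ x ∂(lbMeasure z N)) - ∫ x in Iic s, φ x ∂Q|) s) (le_iSup (fun s : ℝ =>
    ENNReal.ofReal |(∫ x in Iic s, ψ x ∂(lbMeasure z N)) - ∫ x in Iic s, ψ x ∂Q|) s))
  rw [← ENNReal.ofReal_add (abs_nonneg _) (abs_nonneg _),
    integral_add (integrable_lbMeasure hz N φ).restrict (integrable_lbMeasure hz N ψ).restrict,
    integral_add hφ.restrict hψ.restrict, add_sub_add_comm]
  exact ENNReal.ofReal_le_ofReal (abs_add_le _ _)

theorem deviation_const_mul (Q : Measure ℝ) (z : ℕ → ℝ × ℝ) (N : ℕ) (c : ℝ) (φ : ℝ → ℝ) :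
    deviation (fun x => c * φ x) z N Q = ENNReal.ofReal |c| * deviation φ z N Q := by
  simp only [deviation, supDeviation]
  rw [ENNReal.mul_iSup]
  refine iSup_congr fun s => ?_
  rw [integral_const_mul, integral_const_mul, ← mul_sub, abs_mul,
    ENNReal.ofReal_mul (abs_nonneg c)]

theorem UniformLaw.const_mul {μ ν : Measure ℝ} {φ : ℝ → ℝ} (h : UniformLaw μ ν φ) (c : ℝ) :
    UniformLaw μ ν (fun x => c * φ x) := by
  filter_upwards [h] with z hz
  simp only [deviation_const_mul]
  simpa using ENNReal.Tendsto.const_mul (a := ENNReal.ofReal |c|) hz (Or.inr ENNReal.ofReal_ne_top)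

theorem UniformLaw.add {μ ν : Measure ℝ} [IsProbabilityMeasure μ] [IsProbabilityMeasure ν]
    (hF : Continuous (cdf μ)) (hm : μ (reachable ν) ≠ 0) {φ ψ : ℝ → ℝ}
    (hφ : Integrable φ μ) (hψ : Integrable ψ μ) (h : UniformLaw μ ν φ) (h' : UniformLaw μ ν ψ) :
    UniformLaw μ ν (fun x => φ x + ψ x) := by
  have := noAtoms_of_continuous_cdf hF
  filter_upwards [h, h', ae_injective (μ := μ) (ν := ν)] with z hz hz' hinj
  refine tendsto_of_tendsto_of_tendsto_of_le_of_le tendsto_const_nhds (by simpa using hz.add hz')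
    (fun _ => zero_le) fun N => deviation_add_le hinj N (integrable_cond_reachable hm hφ)
      (integrable_cond_reachable hm hψ)

theorem observed_probability_pos {μ ν : Measure ℝ} [IsProbabilityMeasure μ] [IsProbabilityMeasure ν]
    {x : ℝ} (hx : x ∈ reachable ν) (hx1 : cdf μ x < 1) :
    0 < (μ.prod ν).real {w | w.2 ≤ w.1} := by
  have hsub : Ioi x ×ˢ Iic x ⊆ {w : ℝ × ℝ | w.2 ≤ w.1} := by
    rintro w ⟨h1, h2⟩; exact le_trans h2 (le_of_lt (show x < w.1 from h1))
  refine lt_of_lt_of_le ?_ (measureReal_mono hsub)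
  rw [measureReal_prod_prod]
  refine mul_pos ?_ ?_
  · rw [← compl_Iic, probReal_compl_eq_one_sub measurableSet_Iic, ← cdf_eq_real]; linarith
  · rw [← cdf_eq_real]; exact mem_reachable_iff.mp hx

theorem measure_reachable_ne_zero {μ ν : Measure ℝ} [IsProbabilityMeasure μ] {x : ℝ} (hx : x ∈ reachable ν) (hx1 : cdf μ x < 1) :
    μ (reachable ν) ≠ 0 := by
  have hsub : Ioi x ⊆ reachable ν := fun y hy => mem_reachable_of_le hx (le_of_lt hy)
  intro h0
  have h1 : μ.real (Ioi x) = 0 := by rw [measureReal_def, measure_mono_null hsub h0]; rfl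
  rw [← compl_Iic, probReal_compl_eq_one_sub measurableSet_Iic, ← cdf_eq_real] at h1
  linarith

/-- The integrands that satisfy the uniform law are closed under `L¹` limits. -/
theorem UniformLaw.of_tendsto {μ ν : Measure ℝ} [IsProbabilityMeasure μ] [IsProbabilityMeasure ν]
    (hF : Continuous (cdf μ)) (hG : Continuous (cdf ν))
    (hm : μ (reachable ν) ≠ 0) (hα : 0 < (μ.prod ν).real {w | w.2 ≤ w.1}) {φ : ℝ → ℝ}
    {ψ : ℕ → ℝ → ℝ} (hφm : Measurable φ) (hφ : Integrable φ μ) (hψm : ∀ k, Measurable (ψ k))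
    (hψ : ∀ k, Integrable (ψ k) μ) (h : ∀ k, UniformLaw μ ν (ψ k))
    (hlim : Tendsto (fun k => ∫⁻ x, ‖φ x - ψ k x‖ₑ ∂μ) atTop (𝓝 0)) : UniformLaw μ ν φ := by
  set α := (μ.prod ν).real {w | w.2 ≤ w.1}
  have hne : (reachable ν).Nonempty := by
    by_contra hc
    rw [not_nonempty_iff_eq_empty] at hc
    exact hm (by rw [hc]; simp)
  have hmeas : ∀ k, Measurable fun x => ‖φ x - ψ k x‖ₑ := fun k => (hφm.sub (hψm k)).enorm
  have hlim' : Tendsto (fun k => ∫⁻ x in reachable ν, ‖φ x - ψ k x‖ₑ ∂μ) atTop (𝓝 0) :=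
    tendsto_of_tendsto_of_tendsto_of_le_of_le tendsto_const_nhds hlim (fun _ => zero_le)
      fun k => setLIntegral_le_lintegral _ _
  have hK : ∀ n : ℕ, ∃ K, ∀ k ≥ K, ∫⁻ x in reachable ν, ‖φ x - ψ k x‖ₑ ∂μ ≤ (n : ENNReal)⁻¹ :=
    fun n => eventually_atTop.mp (ENNReal.tendsto_nhds_zero.mp hlim' _
      (ENNReal.inv_pos.mpr (ENNReal.natCast_ne_top n)))
  choose K hK using hK
  have h1 : ∀ᵐ z ∂(Measure.infinitePi (fun _ : ℕ => μ.prod ν)), ∀ n : ℕ, ∃ k ≥ K n, ∀ N,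
      weightedMean (fun x => ‖φ x - ψ k x‖ₑ) N z ≤ (n : ENNReal)⁻¹ :=
    ae_all_iff.mpr fun n => ae_exists_forall_weightedMean_le hmeas hlim'
      (ENNReal.inv_ne_zero.mpr (ENNReal.natCast_ne_top n)) (K n)
  have h2 : ∀ᵐ z ∂(Measure.infinitePi (fun _ : ℕ => μ.prod ν)), ∀ k,
      Tendsto (fun N => deviation (ψ k) z N (μ[|reachable ν])) atTop (𝓝 0) := ae_all_iff.mpr h
  filter_upwards [h1, h2, ae_regular hF hG hne] with z hz1 hz2 hz3
  -- Since `n / N` tends to `α`, it eventually exceeds `α / 2`.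
  have hcard : ∀ᶠ N : ℕ in atTop, (N : ENNReal) / (obs z N).card ≤ ENNReal.ofReal (2 / α) := by
    filter_upwards [hz3.obs_lim.eventually (eventually_gt_nhds (half_lt_self hα)),
      eventually_gt_atTop 0] with N hN hN0
    have hN0' : (0 : ℝ) < N := by exact_mod_cast hN0
    have hc : (0 : ℝ) < (obs z N).card := by
      by_contra hc
      have : ((obs z N).card : ℝ) = 0 := le_antisymm (not_lt.mp hc) (by positivity)
      rw [this, zero_div] at hN
      linarith
    rw [← ENNReal.ofReal_natCast, ← ENNReal.ofReal_natCast, ← ENNReal.ofReal_div_of_pos hc]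
    refine ENNReal.ofReal_le_ofReal ?_
    rw [div_le_div_iff₀ hc hα]
    rw [lt_div_iff₀ hN0'] at hN
    linarith
  -- The price of replacing `φ` by `ψ k`: `2 / α` from the domination of the estimator, `(μ
  -- (reachable ν))⁻¹` from conditioning. The index `k` is fixed before `N`, as the bound on the
  -- weighted means holds for all `N`.
  set D : ENNReal := ENNReal.ofReal (2 / α) + (μ (reachable ν))⁻¹
  have hD : D ≠ ⊤ := ENNReal.add_ne_top.mpr ⟨ENNReal.ofReal_ne_top, ENNReal.inv_ne_top.mpr hm⟩
  rw [ENNReal.tendsto_nhds_zero]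
  intro η hη
  have hη2 : 0 < η / 2 := ENNReal.half_pos hη.ne'
  obtain ⟨n, hn⟩ : ∃ n : ℕ, D * (n : ENNReal)⁻¹ ≤ η / 2 := by
    have := ENNReal.Tendsto.const_mul (a := D) ENNReal.tendsto_inv_nat_nhds_zero (Or.inr hD)
    rw [mul_zero] at this
    exact (ENNReal.tendsto_nhds_zero.mp this _ hη2).exists
  obtain ⟨k, hkK, hk⟩ := hz1 n
  filter_upwards [ENNReal.tendsto_nhds_zero.mp (hz2 k) _ hη2, hcard] with N hN1 hN2
  calc deviation φ z N (μ[|reachable ν])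
      ≤ _ := deviation_le_add hz3.injective N (integrable_cond_reachable hm hφ)
        (integrable_cond_reachable hm (hψ k))
    _ ≤ η / 2 + (ENNReal.ofReal (2 / α) * (n : ENNReal)⁻¹
          + (μ (reachable ν))⁻¹ * (n : ENNReal)⁻¹) := by
        gcongr
        · exact (lintegral_lbMeasure_le hz3.injective.injOn _).trans (mul_le_mul' hN2 (hk N))
        · rw [ProbabilityTheory.cond, lintegral_smul_measure, smul_eq_mul]
          gcongr
          exact hK n k hkK
    _ ≤ η / 2 + η / 2 := by rw [← add_mul]; gcongr
    _ = η := ENNReal.add_halves η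

/-- For such `A` each partial integral is a value of a distribution function, so the deviation is at
most the uniform distance between the distribution functions. Both the whole line and half-lines
qualify. -/
theorem uniformLaw_indicator_of_inter_Iic {μ ν : Measure ℝ} [IsProbabilityMeasure μ] [IsProbabilityMeasure ν]
    (hF : Continuous (cdf μ)) (hG : Continuous (cdf ν))
    (hm : μ (reachable ν) ≠ 0) (hα : 0 < (μ.prod ν).real {w | w.2 ≤ w.1}) {A : Set ℝ}
    (hA : MeasurableSet A) (hAI : ∀ s, ∃ r, A ∩ Iic s = Iic r) :
    UniformLaw μ ν (A.indicator 1) := by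
  have hne : (reachable ν).Nonempty := by
    by_contra hc
    rw [not_nonempty_iff_eq_empty] at hc
    exact hm (by rw [hc]; simp)
  filter_upwards [ae_regular hF hG hne] with z hz
  rw [ENNReal.tendsto_nhds_zero]
  intro η hη
  obtain ⟨ε, hε, hεη⟩ : ∃ ε : ℝ, 0 < ε ∧ ENNReal.ofReal ε ≤ η := by
    obtain ⟨ε, h1, h2⟩ := ENNReal.lt_iff_exists_nnreal_btwn.mp hη
    exact ⟨ε, by exact_mod_cast h1, by rw [ENNReal.ofReal_coe_nnreal]; exact h2.le⟩
  filter_upwards [hz.eventually_abs_sub_cdf_le hF hm hα hε] with N hN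
  refine iSup_le fun s => ?_
  obtain ⟨r, hr⟩ := hAI s
  refine le_trans (ENNReal.ofReal_le_ofReal ?_) hεη
  have e : ∀ M : Measure ℝ, ∫ x in Iic s, A.indicator 1 x ∂M = M.real (Iic r) := fun M => by
    rw [integral_indicator_one hA, measureReal_restrict_apply hA, hr]
  rw [e, e, measureReal_def, lbMeasure_Iic,
    ENNReal.toReal_ofReal (by linarith [survival_le_one z N r])]
  exact hN r

/-- Dynkin's argument from half-lines: complements follow by linearity, and countable disjoint
unions are `L¹` limits of finite ones. -/
theorem uniformLaw_indicator {μ ν : Measure ℝ} [IsProbabilityMeasure μ] [IsProbabilityMeasure ν]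
    (hF : Continuous (cdf μ)) (hG : Continuous (cdf ν))
    (hm : μ (reachable ν) ≠ 0) (hα : 0 < (μ.prod ν).real {w | w.2 ≤ w.1}) {A : Set ℝ}
    (hA : MeasurableSet A) : UniformLaw μ ν (A.indicator 1) := by
  have hint : ∀ {B : Set ℝ}, MeasurableSet B → Integrable (B.indicator (1 : ℝ → ℝ)) μ :=
    fun hB => (integrable_const 1).indicator hB
  induction A, hA using MeasurableSpace.induction_on_inter
    ((borel_eq_generateFrom_Iic ℝ).symm ▸ BorelSpace.measurable_eq) isPiSystem_Iic with
  | empty =>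
    have := (uniformLaw_indicator_of_inter_Iic (μ := μ) (ν := ν) hF hG hm hα MeasurableSet.univ
      fun s => ⟨s, univ_inter _⟩).const_mul 0
    simpa using this
  | basic t ht =>
    obtain ⟨r, rfl⟩ := ht
    exact uniformLaw_indicator_of_inter_Iic hF hG hm hα measurableSet_Iic
      fun s => ⟨min r s, Iic_inter_Iic⟩
  | compl t ht ih =>
    have h1 := uniformLaw_indicator_of_inter_Iic (μ := μ) (ν := ν) hF hG hm hα MeasurableSet.univ
      fun s => ⟨s, univ_inter _⟩
    have := h1.add hF hm (hint MeasurableSet.univ) ((hint ht).const_mul (-1)) (ih.const_mul (-1))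
    convert this using 2 with x
    by_cases hx : x ∈ t <;> simp [hx]
  | iUnion f hd hfm ih =>
    have hpart : ∀ k : ℕ, UniformLaw μ ν ((⋃ i ∈ Finset.range k, f i).indicator 1) := by
      intro k
      induction k with
      | zero =>
        have := (ih 0).const_mul 0
        simpa using this
      | succ k ihk =>
        have hm' : MeasurableSet (⋃ i ∈ Finset.range k, f i) :=
          Finset.measurableSet_biUnion _ fun i _ => hfm i
        have := ihk.add hF hm (hint hm') (hint (hfm k)) (ih k)
        convert this using 1
        rw [Finset.range_add_one, Finset.set_biUnion_insert, union_comm,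
          Set.indicator_union_of_disjoint]
        refine Set.disjoint_iUnion₂_left.mpr fun i hi => hd ?_
        have := Finset.mem_range.mp hi; omega
    have hmk : ∀ k, MeasurableSet (⋃ i ∈ Finset.range k, f i) := fun k =>
      Finset.measurableSet_biUnion _ fun i _ => hfm i
    refine UniformLaw.of_tendsto hF hG hm hα
      (measurable_one.indicator (MeasurableSet.iUnion hfm)) (hint (MeasurableSet.iUnion hfm))
      (fun k => measurable_one.indicator (hmk k)) (fun k => hint (hmk k)) hpart ?_
    have hsub : ∀ k, (⋃ i ∈ Finset.range k, f i) ⊆ ⋃ i, f i := fun k =>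
      iUnion₂_subset fun i _ => subset_iUnion f i
    have := tendsto_lintegral_of_dominated_convergence (μ := μ) (fun _ => (1 : ENNReal))
      (F := fun k x => ‖(⋃ i, f i).indicator (1 : ℝ → ℝ) x
        - (⋃ i ∈ Finset.range k, f i).indicator 1 x‖ₑ) (f := fun _ => 0)
      (fun k => ((measurable_one.indicator (MeasurableSet.iUnion hfm)).sub
        (measurable_one.indicator (hmk k))).enorm) (fun k => ae_of_all _ fun x => ?_) (by simp)
      (ae_of_all _ fun x => ?_)
    · simpa using this
    · beta_reduce
      by_cases h1 : x ∈ ⋃ i ∈ Finset.range k, f i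
      · rw [Set.indicator_of_mem h1, Set.indicator_of_mem (hsub k h1)]; simp
      · rw [Set.indicator_of_notMem h1]
        by_cases h2 : x ∈ ⋃ i, f i
        · rw [Set.indicator_of_mem h2]; simp
        · rw [Set.indicator_of_notMem h2]; simp
    · refine tendsto_const_nhds.congr' ?_
      by_cases h2 : x ∈ ⋃ i, f i
      · obtain ⟨j, hj⟩ := mem_iUnion.mp h2
        filter_upwards [eventually_gt_atTop j] with k hk
        rw [Set.indicator_of_mem h2, Set.indicator_of_mem
          (mem_iUnion₂.mpr ⟨j, Finset.mem_range.mpr hk, hj⟩)]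
        simp
      · filter_upwards with k
        rw [Set.indicator_of_notMem h2, Set.indicator_of_notMem fun h => h2 (hsub k h)]
        simp

theorem uniformLaw_simpleFunc {μ ν : Measure ℝ} [IsProbabilityMeasure μ] [IsProbabilityMeasure ν]
    (hF : Continuous (cdf μ)) (hG : Continuous (cdf ν))
    (hm : μ (reachable ν) ≠ 0) (hα : 0 < (μ.prod ν).real {w | w.2 ≤ w.1}) (g : SimpleFunc ℝ ℝ) :
    UniformLaw μ ν g := by
  induction g using SimpleFunc.induction with
  | const c hs =>
    rename_i s
    convert (uniformLaw_indicator (ν := ν) hF hG hm hα hs).const_mul c using 2 with x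
    by_cases hx : x ∈ s <;> simp [hx]
  | add _ hf hg =>
    rename_i f g _
    exact hf.add hF hm (SimpleFunc.integrable_of_isFiniteMeasure f)
      (SimpleFunc.integrable_of_isFiniteMeasure g) hg

theorem uniformLaw_of_integrable {μ ν : Measure ℝ} [IsProbabilityMeasure μ] [IsProbabilityMeasure ν]
    (hF : Continuous (cdf μ)) (hG : Continuous (cdf ν))
    (hm : μ (reachable ν) ≠ 0) (hα : 0 < (μ.prod ν).real {w | w.2 ≤ w.1}) {φ : ℝ → ℝ}
    (hφm : Measurable φ) (hφ : Integrable φ μ) : UniformLaw μ ν φ := by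
  have hex : ∀ k : ℕ, ∃ g : SimpleFunc ℝ ℝ, ∫⁻ x, ‖φ x - g x‖ₑ ∂μ ≤ (k : ENNReal)⁻¹ := by
    intro k
    obtain ⟨g, hg, -⟩ := (memLp_one_iff_integrable.mpr hφ).exists_simpleFunc_eLpNorm_sub_lt
      ENNReal.one_ne_top (ENNReal.inv_ne_zero.mpr (ENNReal.natCast_ne_top k))
    rw [eLpNorm_one_eq_lintegral_enorm] at hg
    exact ⟨g, hg.le⟩
  choose g hg using hex
  exact UniformLaw.of_tendsto hF hG hm hα hφm hφ (fun k => (g k).measurable)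
    (fun k => SimpleFunc.integrable_of_isFiniteMeasure (g k))
    (fun k => uniformLaw_simpleFunc hF hG hm hα (g k))
    (tendsto_of_tendsto_of_tendsto_of_le_of_le tendsto_const_nhds
      ENNReal.tendsto_inv_nat_nhds_zero (fun _ => zero_le) hg)

/-! ### The identifiable law and the main theorem -/

/-- The two sets differ at most in the point `a_G`, which `μ` does not charge. -/
theorem setOf_lowerEnd_le_ae_eq {μ ν : Measure ℝ} [NullSingletonClass μ]
    [IsProbabilityMeasure ν] :
    {x : ℝ | lowerEnd (cdf ν) ≤ (x : EReal)} =ᵐ[μ] reachable ν := by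
  have hsub : reachable ν ⊆ {x : ℝ | lowerEnd (cdf ν) ≤ (x : EReal)} := fun x hx =>
    sInf_le (Set.mem_image_of_mem (fun x : ℝ => (x : EReal))
      (show x ∈ {x | 0 < cdf ν x} from mem_reachable_iff.mp hx))
  refine ae_eq_set.mpr ⟨?_, ?_⟩
  · refine Set.Subsingleton.measure_zero ?_ μ
    have hkey : ∀ x ∈ {x : ℝ | lowerEnd (cdf ν) ≤ (x : EReal)} \ reachable ν,
        (x : EReal) = lowerEnd (cdf ν) := by
      rintro x ⟨h1, h2⟩
      refine le_antisymm (le_sInf ?_) h1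
      rintro _ ⟨y, hy, rfl⟩
      change (x : EReal) ≤ (y : EReal)
      rw [EReal.coe_le_coe_iff]
      by_contra! hc
      exact h2 (mem_reachable_of_le (mem_reachable_iff.mpr hy) hc.le)
    intro x hx y hy
    exact EReal.coe_injective ((hkey x hx).trans (hkey y hy).symm)
  · rw [Set.sdiff_eq_empty.mpr hsub, measure_empty]

theorem identifiableLaw_eq {μ ν : Measure ℝ} [NullSingletonClass μ] [IsProbabilityMeasure ν] :
    identifiableLaw μ ν = μ[|reachable ν] := by
  rw [identifiableLaw, ProbabilityTheory.cond, ProbabilityTheory.cond,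
    measure_congr setOf_lowerEnd_le_ae_eq, Measure.restrict_congr_set setOf_lowerEnd_le_ae_eq]

/-- The complement is covered by countably many null half-lines with rational end points and at most
one further point, its maximum. -/
theorem measure_compl_reachable_self {μ : Measure ℝ} [NullSingletonClass μ] :
    μ (reachable μ)ᶜ = 0 := by
  have hcov : (reachable μ)ᶜ ⊆ (⋃ q ∈ {q : ℚ | (q : ℝ) ∉ reachable μ}, Iic (q : ℝ))
      ∪ {x | x ∉ reachable μ ∧ ∀ y ∉ reachable μ, y ≤ x} := by
    intro x hx
    by_cases h : ∃ q : ℚ, (q : ℝ) ∉ reachable μ ∧ x ≤ q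
    · obtain ⟨q, h1, h2⟩ := h
      exact Or.inl (mem_iUnion₂.mpr ⟨q, h1, h2⟩)
    · push Not at h
      refine Or.inr ⟨hx, fun y hy => ?_⟩
      by_contra! hxy
      obtain ⟨q, h1, h2⟩ := exists_rat_btwn hxy
      exact absurd (h q fun hq => hy (mem_reachable_of_le hq h2.le)) (not_lt.mpr h1.le)
  refine measure_mono_null hcov (measure_union_null ?_ ?_)
  · refine (measure_biUnion_null_iff (Set.to_countable _)).mpr fun q hq => ?_
    exact not_not.mp hq
  · exact Set.Subsingleton.measure_zero (fun x hx y hy => le_antisymm (hy.2 x hx.1) (hx.2 y hy.1)) μ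

theorem identifiableLaw_eq_self {μ ν : Measure ℝ} [IsProbabilityMeasure μ] [NullSingletonClass μ]
    (h : lowerEnd (cdf ν) ≤ lowerEnd (cdf μ)) : identifiableLaw μ ν = μ := by
  have hc : μ {x : ℝ | lowerEnd (cdf ν) ≤ (x : EReal)}ᶜ = 0 := by
    refine measure_mono_null (Set.compl_subset_compl.mpr fun x hx => ?_)
      (measure_compl_reachable_self (μ := μ))
    exact h.trans (sInf_le ⟨x, mem_reachable_iff.mp hx, rfl⟩)
  have hu : {x : ℝ | lowerEnd (cdf ν) ≤ (x : EReal)} =ᵐ[μ] univ :=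
    eventuallyEq_univ.mpr (by rw [mem_ae_iff]; exact hc)
  rw [identifiableLaw, ProbabilityTheory.cond, measure_congr hu, Measure.restrict_congr_set hu]
  simp

end RandomTruncation

theorem mainTheorem2 {Ω : Type*} [MeasurableSpace Ω] (P : Measure Ω) [IsProbabilityMeasure P]
    (μ ν : Measure ℝ) [IsProbabilityMeasure μ] [IsProbabilityMeasure ν]
    (Y T : ℕ → Ω → ℝ) (hYm : ∀ i, Measurable (Y i)) (hTm : ∀ i, Measurable (T i))
    (hindep : iIndepFun (fun i ω => (Y i ω, T i ω)) P)
    (hYT : ∀ i, IndepFun (Y i) (T i) P)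
    (hY : ∀ i, P.map (Y i) = μ) (hT : ∀ i, P.map (T i) = ν)
    (hF : Continuous (cdf μ)) (hG : Continuous (cdf ν))
    (hA : RandomTruncation.lowerEnd (cdf ν) < RandomTruncation.upperEnd (cdf μ))
    (φ₀ : ℝ → ℝ) (hφm : Measurable φ₀) (hφ : Integrable φ₀ μ) :
    (∀ᵐ ω ∂P, Tendsto
      (fun N => RandomTruncation.sampleSize (fun i => Y i ω) (fun i => T i ω) N) atTop atTop) ∧
    (∀ᵐ ω ∂P, Tendsto
      (fun N => RandomTruncation.supDeviation φ₀ (fun i => Y i ω) (fun i => T i ω) N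
        (RandomTruncation.identifiableLaw μ ν)) atTop (𝓝 0)) ∧
    (RandomTruncation.lowerEnd (cdf ν) ≤ RandomTruncation.lowerEnd (cdf μ) →
      ∀ᵐ ω ∂P, Tendsto
        (fun N => RandomTruncation.supDeviation φ₀ (fun i => Y i ω) (fun i => T i ω) N μ)
        atTop (𝓝 0)) := by
  have hμ := RandomTruncation.noAtoms_of_continuous_cdf hF
  -- Independence between and within the pairs identifies the law of the whole sequence, so almost
  -- sure statements transfer from the product space.
  have hmap : P.map (fun ω i => (Y i ω, T i ω)) = Measure.infinitePi (fun _ : ℕ => μ.prod ν) := by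
    have h1 := (iIndepFun_iff_map_fun_eq_infinitePi_map
      fun i => (hYm i).prodMk (hTm i)).mp hindep
    rw [h1]
    congr 1
    funext i
    rw [(indepFun_iff_map_prod_eq_prod_map_map (hYm i).aemeasurable (hTm i).aemeasurable).mp
      (hYT i), hY, hT]
  have hmZ : Measurable (fun ω i => (Y i ω, T i ω)) :=
    measurable_pi_lambda _ fun i => (hYm i).prodMk (hTm i)
  -- Between `a_G` and `b_F` there is a point with `G > 0` and `F < 1`. It makes both the
  -- observation probability and the mass of the reachable set positive.
  obtain ⟨x, hx, hx1⟩ : ∃ x, x ∈ RandomTruncation.reachable ν ∧ cdf μ x < 1 := by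
    obtain ⟨_, ⟨b, hb, rfl⟩, hb'⟩ := lt_sSup_iff.mp hA
    obtain ⟨_, ⟨a, ha, rfl⟩, hab⟩ := sInf_lt_iff.mp hb'
    exact ⟨a, RandomTruncation.mem_reachable_iff.mpr ha,
      (monotone_cdf μ (EReal.coe_lt_coe_iff.mp hab).le).trans_lt hb⟩
  have hα := RandomTruncation.observed_probability_pos hx hx1
  have hm := RandomTruncation.measure_reachable_ne_zero hx hx1
  have main : ∀ᵐ ω ∂P, Tendsto
      (fun N => RandomTruncation.supDeviation φ₀ (fun i => Y i ω) (fun i => T i ω) N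
        (RandomTruncation.identifiableLaw μ ν)) atTop (𝓝 0) := by
    have h := RandomTruncation.uniformLaw_of_integrable hF hG hm hα hφm hφ
    rw [RandomTruncation.UniformLaw, ← hmap] at h
    rw [RandomTruncation.identifiableLaw_eq]
    exact ae_of_ae_map hmZ.aemeasurable h
  refine ⟨?_, main, fun hle => ?_⟩
  · have h := RandomTruncation.ae_regular hF hG ⟨x, hx⟩
    rw [← hmap] at h
    filter_upwards [ae_of_ae_map hmZ.aemeasurable h] with ω hω
    rw [← tendsto_natCast_atTop_iff (R := ℝ)]
    -- Here `n = (n / N) * N`, with `n / N` tending to a positive limit.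
    refine (hω.obs_lim.pos_mul_atTop hα (tendsto_natCast_atTop_atTop (R := ℝ))).congr' ?_
    filter_upwards [eventually_gt_atTop 0] with N hN
    have : (N : ℝ) ≠ 0 := by exact_mod_cast hN.ne'
    rw [div_mul_cancel₀ _ this]
    rfl
  · rwa [RandomTruncation.identifiableLaw_eq_self hle] at main
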